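/- Let the spatial domain be either the torus $U=\mathbb T^2=\mathbb R^2/(2\pi\mathbb Z)^2$ (periodic boundary conditions) or a bounded domain $U\subset\mathbb R^2$ with $C^2$ boundary (Neumann boundary conditions). Put $H=L^2(U)$ with norm $\|\cdot\|_{L^2}$, $X=C^0(\overline U)$ with the sup norm, $V=H^1(U)$, $f(w)=w-w^3$. For $\varepsilon\in(0,1)$ let $$A_\varepsilon=(1-\varepsilon-\varepsilon\Delta)\Delta,\qquad F_\varepsilon(w)=(1-\varepsilon-\varepsilon\Delta)f(w),$$ and let $V_\varepsilon$ be $H^2(U)$ (with the boundary condition $\partial_n\varphi=0$ in the Neumann case) with the norm $\|\varphi\|_{V_\varepsilon}^2=\|\varphi\|_{L^2}^2-\langle A_\varepsilon\varphi,\varphi\rangle$. For $\varphi,\psi\in V_\varepsilon$ and $w\in X$ the values in the dual $V_\varepsilon'$ are $\langle A_\varepsilon\varphi,\psi\rangle=(1-\varepsilon)\langle\Delta\varphi,\psi\rangle_{L^2}-\varepsilon\langle\Delta\varphi,\Delta\psi\rangle_{L^2}$ and $\langle F_\varepsilon(w),\psi\rangle=(1-\varepsilon)\langle f(w),\psi\rangle_{L^2}-\varepsilon\langle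 f(w),\Delta\psi\rangle_{L^2}$. **(i) Nonlinear estimate.** There are $\delta>0$, $C\ge 0$ and $\varepsilon_1>0$ such that for all $\varepsilon\in(0,\varepsilon_1)$, all $\varphi\in V_\varepsilon\cap X$ (which is $V_\varepsilon$, by Sobolev embedding) and all $\psi\in X$ with $\varepsilon^{1/4}\|\psi\|_{C^0}\le 1$, $$\langle A_\varepsilon\varphi,\varphi\rangle+\langle F_\varepsilon(\varphi+\psi)-F_\varepsilon(\psi),\varphi\rangle\le-\delta\|\varphi\|_{V_\varepsilon}^2+C\|\varphi\|_{L^2}^2 .$$ **(ii) Error estimate.** For every $T>0$ there is a constant $K>0$ with the following property. Let $C_0\in\mathbb R$ and let $u\in L^2([0,T],V)\cap C^0([0,T],X)$ with $\partial_tu\in L^2([0,T],V')$ be a weak solution of $$\partial_tu=\Delta u+u-u^3-3C_0u .$$ Then for all sufficiently small $\varepsilon>0$ (how small may depend on $T$ and $u$) the following holds. Let $\sigma_\varepsilon\in\mathbb R$, let $W$ be a cylindrical Wiener process on $L^2(U)$ (so $\partial_tW$ is space-time white noise) on a probability space, let $$Z_\varepsilon(t)=\int_0^te^{(t-s)A_\varepsilon}\sigma_\varepsilon\,dW(s),$$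 and assume that $Z_\varepsilon\in C^0([0,T],X)$ almost surely. Let $u_\varepsilon$ be a solution of $\partial_tu_\varepsilon=A_\varepsilon u_\varepsilon+F_\varepsilon(u_\varepsilon)+\sigma_\varepsilon\partial_tW$, that is, almost surely $v_\varepsilon=u_\varepsilon-Z_\varepsilon\in L^2([0,T],V_\varepsilon)\cap C^0([0,T],X)$ is a weak solution of $\partial_tv_\varepsilon=A_\varepsilon v_\varepsilon+F_\varepsilon(v_\varepsilon+Z_\varepsilon)$. Assume also that almost surely $u-v_\varepsilon\in L^2([0,T],V_\varepsilon)$. Then for all $\gamma>0$ $$\begin{aligned}\mathbb P\Big(\sup_{[0,T]}\|u_\varepsilon-u-Z_\varepsilon\|_{L^2}^2>K\gamma\Big)\le{}&\mathbb P\Big(\varepsilon^{1/4}\sup_{[0,T]}\|Z_\varepsilon\|_{C^0}>\tfrac12\Big)+\mathbb P\big(\|u(0)-u_\varepsilon(0)\|_{L^2}^2>\gamma\big)\\&+\mathbb P\Big(\int_0^T\|\mathrm{Res}_\varepsilon(u)\|_{V_\varepsilon'}^2\,dt>\gamma\Big),\end{aligned}$$ where $\mathrm{Res}_\varepsilon(u)(t)=\partial_tu(t)-A_\varepsilon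 u(t)-F_\varepsilon(u(t)+Z_\varepsilon(t))$, whose $V_\varepsilon'$-norm is taken to be $\infty$ if it is not well defined in $V_\varepsilon'$. -/

import Mathlib

open MeasureTheory ProbabilityTheory Set Filter Topology
open scoped ENNReal NNReal

noncomputable section

namespace CHAC

instance factTwoPi : Fact (0 < 2 * Real.pi) := ⟨Real.two_pi_pos⟩

/-- The Euclidean plane. -/
abbrev Plane : Type := EuclideanSpace ℝ (Fin 2)

/-- The flat torus `ℝ² / (2πℤ)²`. -/
abbrev Torus2 : Type := Fin 2 → AddCircle (2 * Real.pi)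

/-- The covering map of the torus. -/
def torusProj (x : Plane) : Torus2 := fun i => ((x i : ℝ) : AddCircle (2 * Real.pi))

/-- The `i`-th partial derivative of a function on the plane. -/
def partialDeriv (i : Fin 2) (φ : Plane → ℝ) (x : Plane) : ℝ :=
  fderiv ℝ φ x (EuclideanSpace.single i 1)

/-- A bounded domain in the plane (nonempty, open, connected) with `C²` boundary: near each
boundary point it is the sublevel set `{ρ < 0}` of a `C²` function with nonvanishing
differential. -/
structure IsSmoothBoundedDomain (U : Set Plane) : Prop where
  isOpen : IsOpen U
  isConnected : IsConnected U
  isBounded : Bornology.IsBounded U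
  boundary : ∀ x ∈ frontier U, ∃ (N : Set Plane) (ρ : Plane → ℝ), IsOpen N ∧ x ∈ N ∧
    ContDiff ℝ 2 ρ ∧ ρ x = 0 ∧ fderiv ℝ ρ x ≠ 0 ∧ U ∩ N = {y ∈ N | ρ y < 0}

/-- The data of a spatial domain that enter the equations: the compact space `K` (the closed
domain, or the torus), Lebesgue measure on it, and the test functions `φ` for weak derivatives,
listed as pairs `(φ, (∂₁φ, ∂₂φ))`. Only `torus` and `neumann U` below are used. -/
structure SpatialDomain where
  K : Type
  [top : TopologicalSpace K]
  [comp : CompactSpace K]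
  [meas : MeasurableSpace K]
  [borel : BorelSpace K]
  μ : Measure K
  [fin : IsFiniteMeasure μ]
  test : Set (C(K, ℝ) × (Fin 2 → C(K, ℝ)))

attribute [instance] SpatialDomain.top SpatialDomain.comp SpatialDomain.meas
  SpatialDomain.borel SpatialDomain.fin

/-- The torus (periodic boundary conditions); the test functions are all smooth functions. -/
def torus : SpatialDomain where
  K := Torus2
  μ := volume
  test := {p | ContDiff ℝ (⊤ : ℕ∞) (fun x : Plane => p.1 (torusProj x)) ∧
    ∀ (i : Fin 2) (x : Plane),
      p.2 i (torusProj x) = partialDeriv i (fun y : Plane => p.1 (torusProj y)) x}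

/-- The closure of `U` with the Lebesgue measure of `U`; the test functions are the smooth
functions with compact support in `U`. -/
def neumann (U : Set Plane) (hU : IsSmoothBoundedDomain U) : SpatialDomain where
  K := closure U
  comp := isCompact_iff_compactSpace.mp hU.isBounded.isCompact_closure
  μ := (volume.restrict U).comap ((↑) : closure U → Plane)
  fin := by
    constructor
    rw [(MeasurableEmbedding.subtype_coe isClosed_closure.measurableSet).comap_apply]
    refine lt_of_le_of_lt (measure_mono (subset_univ _)) ?_
    rw [Measure.restrict_apply_univ]
    exact hU.isBounded.measure_lt_top
  test := {p | ∃ φ : Plane → ℝ, ContDiff ℝ (⊤ : ℕ∞) φ ∧ HasCompactSupport φ ∧ tsupport φ ⊆ U ∧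
    (∀ x : closure U, p.1 x = φ x) ∧
    ∀ (i : Fin 2) (x : closure U), p.2 i x = partialDeriv i φ x}

/-- The two kinds of domains of the model: the torus with periodic boundary conditions, or a
smooth bounded plane domain with Neumann boundary conditions. -/
def SpatialDomain.IsPeriodicOrNeumann (D : SpatialDomain) : Prop :=
  D = torus ∨ ∃ (U : Set Plane) (hU : IsSmoothBoundedDomain U), D = neumann U hU

namespace SpatialDomain

variable (D : SpatialDomain)

/-- `H = L²`. -/
abbrev H : Type := Lp ℝ 2 D.μ

/-- `X = C⁰` with the sup norm. -/
abbrev X : Type := C(D.K, ℝ)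

/-- The embedding of `C⁰` into `L²`. -/
def emb : D.X →L[ℝ] D.H := ContinuousMap.toLp 2 D.μ ℝ

/-- `g` is the weak derivative `∂ᵢu`: `∫ u ∂ᵢφ = - ∫ g φ` for all test functions `φ`. -/
def IsWeakDeriv (i : Fin 2) (u g : D.H) : Prop :=
  ∀ p ∈ D.test, inner ℝ u (D.emb (p.2 i)) = - inner ℝ g (D.emb p.1)

/-- The Sobolev space `H¹`; the element `u` is stored with its gradient as `(u, (∂₁u, ∂₂u))`
(the norm is equivalent to the usual one). -/
def H1 : Submodule ℝ (D.H × (Fin 2 → D.H)) where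
  carrier := {x | ∀ i, D.IsWeakDeriv i x.1 (x.2 i)}
  add_mem' := by
    intro a b ha hb i p hp
    have h1 := ha i p hp
    have h2 := hb i p hp
    simp only [Prod.fst_add, Prod.snd_add, Pi.add_apply, inner_add_left]
    rw [h1, h2]; ring
  zero_mem' := by intro i p hp; simp
  smul_mem' := by
    intro c a ha i p hp
    have h1 := ha i p hp
    simp only [Prod.smul_fst, Prod.smul_snd, Pi.smul_apply, inner_smul_left]
    rw [h1]; simp

/-- The Sobolev space `H²` with homogeneous Neumann boundary condition. The element `u` is
stored with its weak derivatives as `(u, (∂ᵢu)ᵢ, (∂ⱼ∂ᵢu)ᵢⱼ)`. The Neumann condition is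
Green's formula `∫ ∇u · ∇w = - ∫ Δu w` for all `w ∈ H¹`; on the torus it is satisfied by every
`H²` function. -/
def H2 : Submodule ℝ (D.H × (Fin 2 → D.H) × (Fin 2 → Fin 2 → D.H)) where
  carrier := {x | (∀ i, D.IsWeakDeriv i x.1 (x.2.1 i)) ∧
    (∀ i j, D.IsWeakDeriv j (x.2.1 i) (x.2.2 i j)) ∧
    ∀ w : D.H1, ∑ i, inner ℝ (x.2.1 i) (w.1.2 i) = - inner ℝ (∑ i, x.2.2 i i) w.1.1}
  add_mem' := by
    rintro a b ⟨ha, ha', ha''⟩ ⟨hb, hb', hb''⟩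
    refine ⟨fun i p hp => ?_, fun i j p hp => ?_, fun w => ?_⟩
    · have h1 := ha i p hp
      have h2 := hb i p hp
      simp only [Prod.fst_add, Prod.snd_add, Pi.add_apply, inner_add_left]
      rw [h1, h2]; ring
    · have h1 := ha' i j p hp
      have h2 := hb' i j p hp
      simp only [Prod.fst_add, Prod.snd_add, Pi.add_apply, inner_add_left]
      rw [h1, h2]; ring
    · have h1 := ha'' w
      have h2 := hb'' w
      simp only [Prod.fst_add, Prod.snd_add, Pi.add_apply, inner_add_left,
        Finset.sum_add_distrib]
      rw [h1, h2]; ring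
  zero_mem' := by
    refine ⟨fun i p hp => ?_, fun i j p hp => ?_, fun w => ?_⟩ <;> simp
  smul_mem' := by
    rintro c a ⟨ha, ha', ha''⟩
    refine ⟨fun i p hp => ?_, fun i j p hp => ?_, fun w => ?_⟩
    · have h1 := ha i p hp
      simp only [Prod.smul_fst, Prod.smul_snd, Pi.smul_apply, inner_smul_left]
      rw [h1]; simp
    · have h1 := ha' i j p hp
      simp only [Prod.smul_fst, Prod.smul_snd, Pi.smul_apply, inner_smul_left]
      rw [h1]; simp
    · have h1 := ha'' w
      simp only [Prod.smul_fst, Prod.smul_snd, Pi.smul_apply, inner_smul_left,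
        ← Finset.smul_sum, ← Finset.mul_sum]
      rw [h1]; simp

variable {D}

/-- The inclusion `H² ⊂ H¹`. -/
def toH1 (u : D.H2) : D.H1 := ⟨(u.1.1, u.1.2.1), u.2.1⟩

/-- The Laplacian `Δ : H² → L²`. -/
def lap (u : D.H2) : D.H := ∑ i, u.1.2.2 i i

/-- `⟨Δu, ψ⟩ = - ∫ ∇u · ∇ψ` for `u, ψ ∈ V = H¹`. -/
def lapForm (u ψ : D.H1) : ℝ := - ∑ i, inner ℝ (u.1.2 i) (ψ.1.2 i)

/-- The cubic nonlinearity `f(w) = w - w³`. -/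
def cubic (w : D.X) : D.X := w - w ^ 3

/-- `⟨A_ε u, ψ⟩` for `A_ε = (1 - ε - εΔ)Δ` and `u, ψ ∈ V_ε`. -/
def aForm (ε : ℝ) (u ψ : D.H2) : ℝ :=
  (1 - ε) * inner ℝ (lap u) ψ.1.1 - ε * inner ℝ (lap u) (lap ψ)

/-- `⟨F_ε(w), ψ⟩` for `F_ε(w) = (1 - ε - εΔ) f(w)`, `w ∈ C⁰` and `ψ ∈ V_ε`. -/
def fForm (ε : ℝ) (w : D.X) (ψ : D.H2) : ℝ :=
  (1 - ε) * inner ℝ (D.emb (cubic w)) ψ.1.1 - ε * inner ℝ (D.emb (cubic w)) (lap ψ)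

/-- The `ε`-dependent norm of `V_ε`: `‖φ‖²_{V_ε} = ‖φ‖²_{L²} - ⟨A_ε φ, φ⟩`. -/
def normV (ε : ℝ) (φ : D.H2) : ℝ := Real.sqrt (‖φ.1.1‖ ^ 2 - aForm ε φ φ)

/-- The norm of `V_ε'`, infinite for functionals that are not bounded on `V_ε`. -/
def dualNorm (ε : ℝ) (l : D.H2 → ℝ) : ℝ≥0∞ :=
  ⨆ (φ : D.H2) (_ : normV ε φ ≤ 1), ‖l φ‖ₑ

/-- The `V_ε'`-norm of the residual `∂ₜu - A_ε u - F_ε(u + z)` at a fixed time, where `du` is the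
value of `∂ₜu` (in the dual of `H¹`). It is infinite if `u` has no version in `V_ε`; the infimum
runs over the only version of `u` in `V_ε`. -/
def resNorm (ε : ℝ) (du : StrongDual ℝ D.H1) (u z : D.X) : ℝ≥0∞ :=
  ⨅ (U : D.H2) (_ : U.1.1 = D.emb u),
    dualNorm ε (fun φ => du (toH1 φ) - aForm ε U φ - fForm ε (u + z) φ)

/-- `u ∈ L²([0,T], H¹)`, where `U` is the same path seen with values in `H¹`. -/
def MemL2H1 (T : ℝ) (u : ℝ → D.X) (U : ℝ → D.H1) : Prop :=
  MemLp U 2 (volume.restrict (Icc 0 T)) ∧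
    ∀ᵐ t ∂(volume.restrict (Icc 0 T)), (U t).1.1 = D.emb (u t)

/-- `v ∈ L²([0,T], V_ε)`, where `U` is the same path seen with values in `V_ε`. -/
def MemL2V (ε T : ℝ) (v : ℝ → D.X) (U : ℝ → D.H2) : Prop :=
  AEStronglyMeasurable U (volume.restrict (Icc 0 T)) ∧
    ∫⁻ t in Icc 0 T, ENNReal.ofReal (normV ε (U t) ^ 2) < ∞ ∧
    ∀ᵐ t ∂(volume.restrict (Icc 0 T)), (U t).1.1 = D.emb (v t)

/-- `du ∈ L²([0,T], (H¹)')` is the time derivative of `u`. -/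
def IsTimeDeriv (T : ℝ) (u : ℝ → D.X) (du : ℝ → StrongDual ℝ D.H1) : Prop :=
  MemLp du 2 (volume.restrict (Icc 0 T)) ∧
    ∀ ψ : D.H1, ∀ t ∈ Icc 0 T,
      inner ℝ (D.emb (u t)) ψ.1.1 = inner ℝ (D.emb (u 0)) ψ.1.1 + ∫ s in (0 : ℝ)..t, du s ψ

/-- `u ∈ L²([0,T], H¹) ∩ C⁰([0,T], C⁰)` with `∂ₜu = du ∈ L²([0,T], (H¹)')` is a weak solution of
`∂ₜu = Δu + u - u³ - 3 C₀ u`. -/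
def IsLimitSolution (T C₀ : ℝ) (u : ℝ → D.X) (du : ℝ → StrongDual ℝ D.H1) : Prop :=
  ContinuousOn u (Icc 0 T) ∧ IsTimeDeriv T u du ∧
  ∃ U : ℝ → D.H1, MemL2H1 T u U ∧
    ∀ ψ : D.H1, ∀ t ∈ Icc 0 T,
      inner ℝ (D.emb (u t)) ψ.1.1 = inner ℝ (D.emb (u 0)) ψ.1.1
        + (∫ s in (0 : ℝ)..t, lapForm (U s) ψ)
        + ∫ s in (0 : ℝ)..t, inner ℝ (D.emb (cubic (u s) - (3 * C₀) • u s)) ψ.1.1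

/-- For a given path `z`, the path `v ∈ L²([0,T], V_ε) ∩ C⁰([0,T], C⁰)` is a weak solution of
`∂ₜv = A_ε v + F_ε(v + z)` (then `∂ₜv ∈ L²([0,T], V_ε')` by the equation). -/
def IsTransformedSolution (ε T : ℝ) (z v : ℝ → D.X) : Prop :=
  ContinuousOn v (Icc 0 T) ∧
  ∃ U : ℝ → D.H2, MemL2V ε T v U ∧
    ∀ ψ : D.H2, ∀ t ∈ Icc 0 T,
      inner ℝ (D.emb (v t)) ψ.1.1 = inner ℝ (D.emb (v 0)) ψ.1.1
        + (∫ s in (0 : ℝ)..t, aForm ε (U s) ψ)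
        + ∫ s in (0 : ℝ)..t, fForm ε (v s + z s) ψ

/-- `A_ε h = w` for `A_ε` as an unbounded operator on `L²` (the part of `A_ε : V_ε → V_ε'`
in `L²`). -/
def IsAOp (ε : ℝ) (h w : D.H) : Prop :=
  ∃ U : D.H2, U.1.1 = h ∧ ∀ φ : D.H2, aForm ε U φ = inner ℝ w φ.1.1

/-- `S` (on nonnegative times) is the `C₀`-semigroup on `L²` generated by `A_ε`. -/
structure IsSemigroupOfA (ε : ℝ) (S : ℝ → D.H →L[ℝ] D.H) : Prop where
  zero : S 0 = ContinuousLinearMap.id ℝ D.H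
  add : ∀ s t : ℝ, 0 ≤ s → 0 ≤ t → S (s + t) = (S s).comp (S t)
  continuous : ∀ h : D.H, Tendsto (fun t => S t h) (𝓝[>] 0) (𝓝 h)
  generator : ∀ h w : D.H,
    Tendsto (fun t : ℝ => t⁻¹ • (S t h - h)) (𝓝[>] 0) (𝓝 w) ↔ IsAOp ε h w

/-- `L²([0,∞); H)`, the space of integrands of Wiener integrals. -/
abbrev TimeL2 (D : SpatialDomain) : Type := Lp D.H 2 (volume.restrict (Ici (0 : ℝ)))

/-- Space-time white noise on `[0,∞)` and the spatial domain, as the isonormal Gaussian process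
over `L²([0,∞); H)`: `ξ g = ∫₀^∞ ⟨g(s), dW(s)⟩` for the cylindrical Wiener process `W` on `H`. -/
def IsWhiteNoise {Ω : Type*} [MeasurableSpace Ω] (P : Measure Ω)
    (ξ : D.TimeL2 →ₗ[ℝ] Lp ℝ 2 P) : Prop :=
  ∀ g : D.TimeL2, HasLaw (fun ω => ξ g ω) (gaussianReal 0 (‖g‖₊ ^ 2)) P

open Classical in
/-- `Z` is the stochastic convolution `Z(t) = ∫₀ᵗ S(t-s) σ dW(s)`, `S(t) = e^{t A_ε}`, on `[0,T]`:
for every `h ∈ H` the variable `⟨Z(t), h⟩` is the Wiener integral of `s ↦ 1_{s < t} σ S(t-s)* h`. -/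
def IsStochasticConvolution {Ω : Type*} [MeasurableSpace Ω] (P : Measure Ω)
    (ξ : D.TimeL2 →ₗ[ℝ] Lp ℝ 2 P) (ε σ T : ℝ) (Z : Ω → ℝ → D.X) : Prop :=
  ∃ S : ℝ → D.H →L[ℝ] D.H, IsSemigroupOfA ε S ∧
    ∀ t ∈ Icc 0 T, ∀ h : D.H, ∃ g : D.TimeL2,
      (∀ᵐ s ∂(volume.restrict (Ici (0 : ℝ))),
        g s = if s < t then σ • ContinuousLinearMap.adjoint (S (t - s)) h else 0) ∧
      ∀ᵐ ω ∂P, inner ℝ (D.emb (Z ω t)) h = ξ g ω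

end SpatialDomain

end CHAC

end

noncomputable section

namespace CHAC

namespace SpatialDomain

variable {D : SpatialDomain}

theorem inner_emb_emb (a b : D.X) : inner ℝ (D.emb a) (D.emb b) = ∫ x, a x * b x ∂D.μ := by
  unfold emb
  rw [ContinuousMap.inner_toLp]
  simp [mul_comm]

theorem inner_emb_mul (a b c : D.X) :
    inner ℝ (D.emb (a * b)) (D.emb c) = inner ℝ (D.emb a) (D.emb (b * c)) := by
  rw [inner_emb_emb, inner_emb_emb]
  simp [mul_assoc]

theorem inner_coeFn_emb (g : D.H) (b : D.X) : inner ℝ g (D.emb b) = ∫ x, g x * b x ∂D.μ := by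
  rw [L2.inner_def]
  refine integral_congr_ae ?_
  filter_upwards [ContinuousMap.coeFn_toLp (p := 2) (𝕜 := ℝ) D.μ b] with x hx
  have : (D.emb b) x = b x := hx
  simp [this, mul_comm]

theorem norm_emb_mul_le (a b : D.X) : ‖D.emb (a * b)‖ ≤ ‖a‖ * ‖D.emb b‖ := by
  refine Lp.norm_le_mul_norm_of_ae_le_mul ?_
  filter_upwards [ContinuousMap.coeFn_toLp (p := 2) (𝕜 := ℝ) D.μ b,
    ContinuousMap.coeFn_toLp (p := 2) (𝕜 := ℝ) D.μ (a * b)] with x h1 h2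
  have h1' : (D.emb b) x = b x := h1
  have h2' : (D.emb (a * b)) x = a x * b x := h2
  rw [h1', h2', norm_mul]
  gcongr
  exact a.norm_coe_le_norm x

/-- Multiplication of an `L²` function by a continuous function. -/
theorem exists_continuous_mul (a : D.X) (g : D.H) :
    ∃ h : D.H, (∀ b : D.X, inner ℝ h (D.emb b) = inner ℝ g (D.emb (a * b))) ∧
      ((∀ x, 0 ≤ a x) → 0 ≤ inner ℝ g h) := by
  have hm : MemLp (fun x => a x * g x) 2 D.μ := by
    refine MemLp.of_le_mul (c := ‖a‖) (Lp.memLp g)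
      (a.continuous.aestronglyMeasurable.mul (Lp.aestronglyMeasurable g)) ?_
    filter_upwards with x
    rw [norm_mul]
    gcongr
    exact a.norm_coe_le_norm x
  refine ⟨hm.toLp _, fun b => ?_, fun ha => ?_⟩
  · rw [inner_coeFn_emb, inner_coeFn_emb]
    refine integral_congr_ae ?_
    filter_upwards [hm.coeFn_toLp] with x hx
    rw [hx]
    simp only [ContinuousMap.mul_apply]
    ring
  · rw [L2.inner_def]
    refine integral_nonneg_of_ae ?_
    filter_upwards [hm.coeFn_toLp] with x hx
    rw [hx]
    have := mul_nonneg (ha x) (mul_self_nonneg (g x))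
    simp only [Pi.zero_apply, RCLike.inner_apply, conj_trivial]
    linarith

/-- Every continuous function can be regularized near the support of a test function, by an
operator that is antisymmetric after differentiation. -/
def HasMollifiers (D : SpatialDomain) : Prop :=
  ∀ p ∈ D.test, ∀ v w : D.X, ∀ κ : ℝ, 0 < κ → ∃ (q : D.X) (q' : Fin 2 → D.X), ∃ r ∈ D.test,
    (p.1 * q, fun i => p.2 i * q + p.1 * q' i) ∈ D.test ∧
    ‖p.1 * (q - w)‖ ≤ κ ∧ (∀ i, ‖p.2 i * (q - w)‖ ≤ κ) ∧
    (∀ i, inner ℝ (D.emb (v * p.1)) (D.emb (q' i)) = - inner ℝ (D.emb w) (D.emb (r.2 i))) ∧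
    ‖r.1 - v * p.1‖ ≤ κ

theorem abs_inner_emb_le (g : D.H) {a : D.X} {κ : ℝ} (h : ‖a‖ ≤ κ) :
    |inner ℝ g (D.emb a)| ≤ κ * (‖g‖ * ‖D.emb‖) := by
  have h1 := abs_real_inner_le_norm g (D.emb a)
  have h2 := D.emb.le_opNorm a
  have h3 : ‖D.emb‖ * ‖a‖ ≤ ‖D.emb‖ * κ := by gcongr
  calc _ ≤ ‖g‖ * ‖D.emb a‖ := h1
    _ ≤ ‖g‖ * (‖D.emb‖ * κ) := by gcongr; exact h2.trans h3
    _ = _ := by ring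

/-- The product rule for weak derivatives of continuous functions. -/
theorem HasMollifiers.inner_emb_mul_test (hD : D.HasMollifiers) {i : Fin 2} {v w : D.X}
    {gv gw : D.H} (hv : D.IsWeakDeriv i (D.emb v) gv) (hw : D.IsWeakDeriv i (D.emb w) gw)
    {p : D.X × (Fin 2 → D.X)} (hp : p ∈ D.test) :
    inner ℝ (D.emb (v * w)) (D.emb (p.2 i)) =
      -(inner ℝ gv (D.emb (w * p.1)) + inner ℝ gw (D.emb (v * p.1))) := by
  rw [← sub_eq_zero]
  set A := inner ℝ (D.emb (v * w)) (D.emb (p.2 i)) -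
      -(inner ℝ gv (D.emb (w * p.1)) + inner ℝ gw (D.emb (v * p.1))) with hA
  set c := ‖D.emb v‖ * ‖D.emb‖ + ‖gv‖ * ‖D.emb‖ + ‖gw‖ * ‖D.emb‖ with hc
  have hc0 : 0 ≤ c := by positivity
  have key : ∀ κ : ℝ, 0 < κ → |A| ≤ κ * c := by
    intro κ hκ
    obtain ⟨q, q', r, hr, hpq, h1, h2, h3, h4⟩ := hD p hp v w κ hκ
    have e1 := hv _ hpq
    have e2 := hw _ hr
    have e3 := h3 i
    simp only [map_add, inner_add_right] at e1
    rw [inner_emb_mul] at e3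
    have e4 : A = - inner ℝ (D.emb v) (D.emb (p.2 i * (q - w)))
        - inner ℝ gv (D.emb (p.1 * (q - w))) - inner ℝ gw (D.emb (r.1 - v * p.1)) := by
      rw [hA, inner_emb_mul, mul_comm w (p.2 i), mul_comm w p.1]
      simp only [mul_sub, map_sub, inner_sub_right]
      linarith
    have b1 := abs_inner_emb_le (D.emb v) (h2 i)
    have b2 := abs_inner_emb_le gv h1
    have b3 := abs_inner_emb_le gw h4
    rw [abs_le] at b1 b2 b3 ⊢
    rw [e4, hc]
    constructor <;> linarith [b1.1, b1.2, b2.1, b2.2, b3.1, b3.2]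
  have : |A| ≤ 0 := by
    refine le_of_forall_pos_le_add fun κ hκ => ?_
    have := key (κ / (c + 1)) (by positivity)
    refine this.trans ?_
    rw [zero_add, div_mul_eq_mul_div, div_le_iff₀ (by positivity)]
    nlinarith
  exact abs_eq_zero.mp (le_antisymm this (abs_nonneg _))

theorem sum_inner_grad_self (φ : D.H2) :
    inner ℝ (lap φ) φ.1.1 = - ∑ i, ‖φ.1.2.1 i‖ ^ 2 := by
  have := φ.2.2.2 (toH1 φ)
  simp only [toH1, real_inner_self_eq_norm_sq] at this
  rw [this, neg_neg]
  rfl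

/-- Accretivity: `∫ w³ Δw = - ∫ 3 w² |∇w|² ≤ 0`. -/
theorem HasMollifiers.inner_cube_lap_nonpos (hD : D.HasMollifiers) (φ : D.H2) (w : D.X)
    (hw : φ.1.1 = D.emb w) : inner ℝ (D.emb (w ^ 3)) (lap φ) ≤ 0 := by
  have h1 : ∀ i, D.IsWeakDeriv i (D.emb w) (φ.1.2.1 i) := fun i => hw ▸ φ.2.1 i
  choose g hg hg' using fun i => exists_continuous_mul (2 * w) (φ.1.2.1 i)
  have h2 : ∀ i, D.IsWeakDeriv i (D.emb (w * w)) (g i) := by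
    intro i p hp
    rw [hD.inner_emb_mul_test (h1 i) (h1 i) hp, hg, two_mul, add_mul, map_add, inner_add_right]
  choose k hk hk' using fun i => exists_continuous_mul (3 * (w * w)) (φ.1.2.1 i)
  have h3 : ∀ i, D.IsWeakDeriv i (D.emb (w ^ 3)) (k i) := by
    intro i p hp
    rw [show w ^ 3 = (w * w) * w by ring, hD.inner_emb_mul_test (h2 i) (h1 i) hp, hg, hk,
      ← inner_add_right, ← map_add]
    congr 4
    ring
  have h4 := φ.2.2.2 ⟨(D.emb (w ^ 3), k), h3⟩
  rw [real_inner_comm]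
  have h5 : 0 ≤ ∑ i, inner ℝ (φ.1.2.1 i) (k i) := by
    refine Finset.sum_nonneg fun i _ => hk' i fun x => ?_
    have : (3 * (w * w)) x = 3 * (w x * w x) := rfl
    rw [this]
    have := mul_self_nonneg (w x)
    positivity
  change _ = -inner ℝ (lap φ) (D.emb (w ^ 3)) at h4
  simp only at h4
  linarith

end SpatialDomain

end CHAC

end

noncomputable section

namespace CHAC

namespace SpatialDomain

variable {D : SpatialDomain}

theorem aForm_self (ε : ℝ) (φ : D.H2) :
    aForm ε φ φ = -((1 - ε) * ∑ i, ‖φ.1.2.1 i‖ ^ 2) - ε * ‖lap φ‖ ^ 2 := by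
  rw [aForm, sum_inner_grad_self, real_inner_self_eq_norm_sq]
  ring

theorem normV_sq {ε : ℝ} (h0 : 0 ≤ ε) (h1 : ε ≤ 1) (φ : D.H2) :
    normV ε φ ^ 2 = ‖φ.1.1‖ ^ 2 + (1 - ε) * ∑ i, ‖φ.1.2.1 i‖ ^ 2 + ε * ‖lap φ‖ ^ 2 := by
  have h1' : 0 ≤ 1 - ε := by linarith
  have h2 : 0 ≤ ∑ i, ‖φ.1.2.1 i‖ ^ 2 := Finset.sum_nonneg fun i _ => by positivity
  have h3 : 0 ≤ (1 - ε) * ∑ i, ‖φ.1.2.1 i‖ ^ 2 := by positivity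
  have h4 : 0 ≤ ε * ‖lap φ‖ ^ 2 := by positivity
  rw [normV, Real.sq_sqrt, aForm_self]
  · ring
  · rw [aForm_self]
    nlinarith [sq_nonneg ‖φ.1.1‖]

theorem cubic_add_sub (w ψ : D.X) :
    cubic (w + ψ) - cubic ψ = w - w ^ 3 - (3 : ℝ) • (ψ * (w * w) + (ψ * ψ) * w) := by
  ext x
  simp only [cubic, ContinuousMap.sub_apply, ContinuousMap.add_apply, ContinuousMap.pow_apply,
    ContinuousMap.smul_apply, ContinuousMap.mul_apply, smul_eq_mul]
  ring

theorem inner_cubic_add_sub_le (w ψ : D.X) :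
    inner ℝ (D.emb (cubic (w + ψ) - cubic ψ)) (D.emb w) ≤
      ‖D.emb w‖ ^ 2 - 1 / 4 * ‖D.emb (w * w)‖ ^ 2 := by
  have hi : ∀ a : D.X, Integrable (fun x => a x) D.μ := fun a =>
    a.continuous.integrable_of_hasCompactSupport (HasCompactSupport.of_compactSpace _)
  have h : ∀ a b : D.X, inner ℝ (D.emb a) (D.emb b) = ∫ x, (a * b) x ∂D.μ := inner_emb_emb
  have h0 : 0 ≤ ∫ x, (w * w - (1 / 4 : ℝ) • (w * w * (w * w))
      - (cubic (w + ψ) - cubic ψ) * w) x ∂D.μ := by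
    refine integral_nonneg fun x => ?_
    rw [cubic_add_sub]
    simp only [ContinuousMap.sub_apply, ContinuousMap.add_apply, ContinuousMap.pow_apply,
      ContinuousMap.smul_apply, ContinuousMap.mul_apply, smul_eq_mul, Pi.zero_apply]
    nlinarith [sq_nonneg (w x * (w x + 2 * ψ x))]
  have hsub : ∀ a b : D.X, ∫ x, (a - b) x ∂D.μ = ∫ x, a x ∂D.μ - ∫ x, b x ∂D.μ := fun a b =>
    integral_sub (hi a) (hi b)
  have hsmul : ∀ (c : ℝ) (a : D.X), ∫ x, (c • a) x ∂D.μ = c * ∫ x, a x ∂D.μ := fun c a =>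
    integral_const_mul c _
  rw [hsub, hsub, hsmul] at h0
  rw [← real_inner_self_eq_norm_sq, ← real_inner_self_eq_norm_sq, h, h, h]
  linarith

/-- The one-sided estimate for `F_ε`, for shifts of size at most `ε^{-1/4}`. -/
theorem HasMollifiers.one_sided_estimate (hD : D.HasMollifiers) {ε : ℝ} (h0 : 0 < ε)
    (h1 : ε < 1 / 5184) (φ : D.H2) (w ψ : D.X) (hw : φ.1.1 = D.emb w)
    (hψ : ε ^ (1 / 4 : ℝ) * ‖ψ‖ ≤ 1) :
    aForm ε φ φ + (fForm ε (w + ψ) φ - fForm ε ψ φ)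
      ≤ - (1 / 2) * normV ε φ ^ 2 + 11 * ‖φ.1.1‖ ^ 2 := by
  have e1 : fForm ε (w + ψ) φ - fForm ε ψ φ =
      (1 - ε) * inner ℝ (D.emb (cubic (w + ψ) - cubic ψ)) (D.emb w)
      - ε * inner ℝ (D.emb (cubic (w + ψ) - cubic ψ)) (lap φ) := by
    simp only [fForm, map_sub, inner_sub_left, hw]
    ring
  have e2 := inner_cubic_add_sub_le w ψ
  have e3 := sum_inner_grad_self φ
  have e4 := hD.inner_cube_lap_nonpos φ w hw
  have e5 : inner ℝ (D.emb (cubic (w + ψ) - cubic ψ)) (lap φ) =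
      inner ℝ (D.emb w) (lap φ) - inner ℝ (D.emb (w ^ 3)) (lap φ)
      - 3 * (inner ℝ (D.emb (ψ * (w * w))) (lap φ) + inner ℝ (D.emb ((ψ * ψ) * w)) (lap φ)) := by
    rw [cubic_add_sub]
    simp only [map_sub, map_smul, map_add, inner_sub_left, inner_smul_left, inner_add_left]
    simp
  have e6 := real_inner_le_norm (D.emb (ψ * (w * w))) (lap φ)
  have e7 := real_inner_le_norm (D.emb ((ψ * ψ) * w)) (lap φ)
  have e8 := norm_emb_mul_le ψ (w * w)
  have e9 := (norm_emb_mul_le (ψ * ψ) w).trans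
    (mul_le_mul_of_nonneg_right (norm_mul_le ψ ψ) (norm_nonneg _))
  rw [normV_sq h0.le (by linarith), aForm_self, e1, e5]
  rw [real_inner_comm, hw] at e3
  rw [hw]
  have hG : 0 ≤ ∑ i, ‖φ.1.2.1 i‖ ^ 2 := Finset.sum_nonneg fun i _ => by positivity
  set s := ε ^ (1 / 4 : ℝ) with hs
  have hs0 : 0 < s := Real.rpow_pos_of_pos h0 _
  have hs4 : s ^ 4 = ε := by
    rw [hs, ← Real.rpow_natCast, ← Real.rpow_mul h0.le]
    norm_num
  have hs2 : s ^ 2 < 1 / 72 := by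
    refine lt_of_pow_lt_pow_left₀ 2 (by norm_num) ?_
    rw [← pow_mul, hs4]
    norm_num
    linarith
  set G := ∑ i, ‖φ.1.2.1 i‖ ^ 2
  set l := ‖lap φ‖
  set q := ‖D.emb (w * w)‖
  set n := ‖D.emb w‖
  have hl : 0 ≤ l := norm_nonneg _
  have hq : 0 ≤ q := norm_nonneg _
  have hn : 0 ≤ n := norm_nonneg _
  have hM : 0 ≤ ‖ψ‖ := norm_nonneg _
  have b1 : ε * inner ℝ (D.emb (ψ * (w * w))) (lap φ) ≤ (s ^ 2 * l) * (s * q) := by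
    calc _ ≤ ε * (‖ψ‖ * q * l) := by
          refine mul_le_mul_of_nonneg_left (e6.trans ?_) h0.le
          exact mul_le_mul_of_nonneg_right e8 hl
      _ = (s * ‖ψ‖) * ((s ^ 2 * l) * (s * q)) := by rw [← hs4]; ring
      _ ≤ 1 * ((s ^ 2 * l) * (s * q)) := by gcongr
      _ = _ := one_mul _
  have b2 : ε * inner ℝ (D.emb ((ψ * ψ) * w)) (lap φ) ≤ (s ^ 2 * l) * n := by
    calc _ ≤ ε * (‖ψ‖ * ‖ψ‖ * n * l) := by
          refine mul_le_mul_of_nonneg_left (e7.trans ?_) h0.le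
          exact mul_le_mul_of_nonneg_right e9 hl
      _ = (s * ‖ψ‖) * (s * ‖ψ‖) * ((s ^ 2 * l) * n) := by rw [← hs4]; ring
      _ ≤ 1 * 1 * ((s ^ 2 * l) * n) := by gcongr
      _ = _ := by ring
  have b3 : 3 * ((s ^ 2 * l) * (s * q)) ≤ 1 / 4 * (ε * l ^ 2) + 9 * (s ^ 2 * q ^ 2) := by
    rw [← hs4]
    nlinarith [sq_nonneg (1 / 2 * (s ^ 2 * l) - 3 * (s * q))]
  have b4 : 3 * ((s ^ 2 * l) * n) ≤ 1 / 4 * (ε * l ^ 2) + 9 * n ^ 2 := by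
    rw [← hs4]
    nlinarith [sq_nonneg (1 / 2 * (s ^ 2 * l) - 3 * n)]
  have b5 : 9 * (s ^ 2 * q ^ 2) ≤ (1 - ε) * (1 / 4 * q ^ 2) := by
    have : s ^ 2 * q ^ 2 ≤ 1 / 72 * q ^ 2 := by gcongr
    have : ε * q ^ 2 ≤ 1 / 5184 * q ^ 2 := by gcongr
    linarith [sq_nonneg q]
  have b6 : ε * inner ℝ (D.emb (w ^ 3)) (lap φ) ≤ 0 := mul_nonpos_of_nonneg_of_nonpos h0.le e4
  have b7 := mul_le_mul_of_nonneg_left e2 (by linarith : 0 ≤ 1 - ε)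
  have b8 : ε * G ≤ 1 / 5184 * G := mul_le_mul_of_nonneg_right h1.le hG
  have b9 : 0 ≤ ε * n ^ 2 := by positivity
  have b10 : 0 ≤ ε * l ^ 2 := by positivity
  have b11 : 0 ≤ n ^ 2 := by positivity
  have b12 : 0 ≤ q ^ 2 := by positivity
  rw [e3]
  linarith

end SpatialDomain

end CHAC

end

noncomputable section

namespace CHAC

theorem eq_of_lintegral_shift_sub_le {Φ : ℝ → ℝ} {T : ℝ} (hT : 0 < T)
    (hΦ : ContinuousOn Φ (Icc 0 T))
    (h : ∀ κ : ℝ, 0 < κ → ∃ h₀ > (0 : ℝ), ∀ h : ℝ, 0 < h → h < h₀ → h < T →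
      ∫⁻ s in Icc 0 (T - h), ‖Φ (s + h) - Φ s‖ₑ ≤ ENNReal.ofReal (κ * h)) :
    Φ T = Φ 0 := by
  rw [← sub_eq_zero, ← abs_eq_zero]
  refine le_antisymm (le_of_forall_pos_le_add fun κ' hκ' => ?_) (abs_nonneg _)
  obtain ⟨κ, hκ, rfl⟩ : ∃ κ > 0, κ' = 3 * κ := ⟨κ' / 3, by positivity, by ring⟩
  obtain ⟨h₀, h₀pos, hh⟩ := h κ hκ
  obtain ⟨d0, hd0, H0⟩ := Metric.continuousWithinAt_iff.1 (hΦ 0 ⟨le_rfl, hT.le⟩) κ hκ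
  obtain ⟨d1, hd1, H1⟩ := Metric.continuousWithinAt_iff.1 (hΦ T ⟨hT.le, le_rfl⟩) κ hκ
  obtain ⟨η, hη0, hη⟩ : ∃ η > 0, η < min (min h₀ T) (min d0 d1) :=
    exists_between (lt_min (lt_min h₀pos hT) (lt_min hd0 hd1))
  simp only [lt_min_iff] at hη
  obtain ⟨⟨hη1, hη2⟩, hη3, hη4⟩ := hη
  have hle := hh η hη0 hη1 hη2
  have hint : ∀ a b, a ∈ Icc 0 T → b ∈ Icc 0 T → IntervalIntegrable Φ volume a b :=
    fun a b ha hb => (hΦ.mono (ordConnected_Icc.uIcc_subset ha hb)).intervalIntegrable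
  have m0 : (0 : ℝ) ∈ Icc 0 T := ⟨le_rfl, hT.le⟩
  have mT : T ∈ Icc 0 T := ⟨hT.le, le_rfl⟩
  have mη : η ∈ Icc 0 T := ⟨hη0.le, hη2.le⟩
  have mη' : T - η ∈ Icc 0 T := ⟨by linarith, by linarith⟩
  have hshift : IntervalIntegrable (fun s => Φ (s + η)) volume 0 (T - η) := by
    have := (hint η T mη mT).comp_add_right η
    simpa using this
  have e1 : ∫ s in (0 : ℝ)..(T - η), (Φ (s + η) - Φ s) =
      (∫ s in (T - η)..T, Φ s) - ∫ s in (0 : ℝ)..η, Φ s := by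
    rw [intervalIntegral.integral_sub hshift (hint _ _ m0 mη'),
      intervalIntegral.integral_comp_add_right]
    have a1 := intervalIntegral.integral_add_adjacent_intervals (hint _ _ m0 mη) (hint _ _ mη mT)
    have a2 := intervalIntegral.integral_add_adjacent_intervals (hint _ _ m0 mη') (hint _ _ mη' mT)
    simp only [zero_add, sub_add_cancel]
    linarith
  have e2 : |∫ s in (0 : ℝ)..(T - η), (Φ (s + η) - Φ s)| ≤ κ * η := by
    have b0 : ‖∫ s in (0 : ℝ)..(T - η), (Φ (s + η) - Φ s)‖ₑ ≤ ENNReal.ofReal (κ * η) := by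
      rw [intervalIntegral.integral_of_le mη'.1]
      exact (enorm_integral_le_lintegral_enorm _).trans
        ((lintegral_mono_set Ioc_subset_Icc_self).trans hle)
    rw [← Real.norm_eq_abs]
    rw [← ofReal_norm] at b0
    exact (ENNReal.ofReal_le_ofReal_iff (by positivity)).1 b0
  have e3 : |(∫ s in (T - η)..T, Φ s) - η * Φ T| ≤ κ * η := by
    have : (∫ s in (T - η)..T, Φ s) - η * Φ T = ∫ s in (T - η)..T, (Φ s - Φ T) := by
      rw [intervalIntegral.integral_sub (hint _ _ mη' mT) intervalIntegrable_const]
      simp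
    rw [this, ← Real.norm_eq_abs]
    refine (intervalIntegral.norm_integral_le_of_norm_le_const (C := κ) fun s hs => ?_).trans ?_
    · rw [uIoc_of_le (by linarith)] at hs
      refine (H1 (x := s) ⟨by linarith [hs.1], hs.2⟩ ?_).le
      rw [Real.dist_eq, abs_lt]
      constructor <;> linarith [hs.1, hs.2]
    · simp [abs_of_pos hη0]
  have e4 : |(∫ s in (0 : ℝ)..η, Φ s) - η * Φ 0| ≤ κ * η := by
    have : (∫ s in (0 : ℝ)..η, Φ s) - η * Φ 0 = ∫ s in (0 : ℝ)..η, (Φ s - Φ 0) := by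
      rw [intervalIntegral.integral_sub (hint _ _ m0 mη) intervalIntegrable_const]
      simp
    rw [this, ← Real.norm_eq_abs]
    refine (intervalIntegral.norm_integral_le_of_norm_le_const (C := κ) fun s hs => ?_).trans ?_
    · rw [uIoc_of_le hη0.le] at hs
      refine (H0 (x := s) ⟨hs.1.le, by linarith [hs.2]⟩ ?_).le
      rw [Real.dist_eq, abs_lt]
      constructor <;> linarith [hs.1, hs.2]
    · simp [abs_of_pos hη0]
  rw [e1] at e2
  have e5 : |η * (Φ T - Φ 0)| ≤ 3 * κ * η := by
    rw [abs_le] at *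
    constructor <;> nlinarith [e2.1, e2.2, e3.1, e3.2, e4.1, e4.2]
  rw [abs_mul, abs_of_pos hη0, mul_comm] at e5
  have := le_of_mul_le_mul_right e5 hη0
  linarith

theorem tendsto_eLpNorm_shift_sub {V : Type*} [NormedAddCommGroup V] {E : ℝ → V}
    (hE : MemLp E 2 volume) :
    Tendsto (fun τ : ℝ => eLpNorm (fun s => E (s + τ) - E s) 2 volume) (𝓝 0) (𝓝 0) := by
  let g : C(ℝ, C(ℝ, ℝ)) := (ContinuousMap.mk (fun a : ℝ × ℝ => a.2 + a.1) (by fun_prop)).curry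
  have hg : ∀ τ, MeasurePreserving (g τ) volume volume := fun τ =>
    measurePreserving_add_right volume τ
  have h1 : Tendsto (fun τ => Lp.compMeasurePreserving (g τ) (hg τ) (hE.toLp E)) (𝓝 0)
      (𝓝 (Lp.compMeasurePreserving (g 0) (hg 0) (hE.toLp E))) :=
    Filter.Tendsto.compMeasurePreservingLp tendsto_const_nhds (g.continuous.tendsto 0) hg (hg 0)
      (by norm_num)
  rw [tendsto_iff_edist_tendsto_0] at h1
  refine h1.congr fun τ => ?_
  rw [Lp.edist_def]
  refine eLpNorm_congr_ae ?_
  have a1 := Lp.coeFn_compMeasurePreserving (hE.toLp E) (hg τ)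
  have a2 := Lp.coeFn_compMeasurePreserving (hE.toLp E) (hg 0)
  have a3 := (hg τ).quasiMeasurePreserving.ae_eq_comp hE.coeFn_toLp
  have a4 := (hg 0).quasiMeasurePreserving.ae_eq_comp hE.coeFn_toLp
  filter_upwards [a1, a2, a3, a4] with s b1 b2 b3 b4
  rw [Pi.sub_apply, b1, b2, b3, b4]
  simp [g]

theorem lintegral_enorm_mul_enorm_le {α V W : Type*} [MeasurableSpace α] {μ : Measure α}
    [NormedAddCommGroup V] [NormedAddCommGroup W] {f : α → V} {g : α → W}
    (hf : AEStronglyMeasurable f μ) (hg : AEStronglyMeasurable g μ) :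
    ∫⁻ x, ‖f x‖ₑ * ‖g x‖ₑ ∂μ ≤ eLpNorm f 2 μ * eLpNorm g 2 μ := by
  have := ENNReal.lintegral_mul_le_Lp_mul_Lq μ Real.HolderConjugate.two_two hf.enorm hg.enorm
  simpa [eLpNorm_eq_lintegral_rpow_enorm_toReal] using this

end CHAC

end

noncomputable section

namespace CHAC

variable {H V : Type*} [NormedAddCommGroup H] [InnerProductSpace ℝ H]
  [NormedAddCommGroup V] [NormedSpace ℝ V]

theorem integrable_dual_apply {α : Type*} [MeasurableSpace α] {μ : Measure α} {E : α → V}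
    {G : α → StrongDual ℝ V} (hE : MemLp E 2 μ) (hG : MemLp G 2 μ) :
    Integrable (fun r => G r (E r)) μ := by
  refine ⟨isBoundedBilinearMap_apply.continuous.comp_aestronglyMeasurable (hG.1.prodMk hE.1), ?_⟩
  refine lt_of_le_of_lt ?_ (ENNReal.mul_lt_top hG.2 hE.2)
  refine le_trans (lintegral_mono fun r => ?_) (lintegral_enorm_mul_enorm_le hG.1 hE.1)
  exact (G r).le_opENorm (E r)

theorem energy_identity_aux {T : ℝ} (hT : 0 < T) {e : ℝ → H} (he : ContinuousOn e (Icc 0 T))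
    {E : ℝ → V} {G : ℝ → StrongDual ℝ V} (hE : MemLp E 2 volume) (hG : MemLp G 2 volume)
    (hEm : StronglyMeasurable E) (hGm : StronglyMeasurable G)
    (h : ∀ᵐ s, s ∈ Icc 0 T → ∀ t₁ ∈ Icc 0 T, ∀ t₂ ∈ Icc 0 T,
      inner ℝ (e t₂ - e t₁) (e s) = ∫ r in t₁..t₂, G r (E s)) :
    ‖e T‖ ^ 2 - ‖e 0‖ ^ 2 = 2 * ∫ r in (0 : ℝ)..T, G r (E r) := by
  have hGE := integrable_dual_apply hE hG
  have hGv : ∀ (v : V) (a b : ℝ), IntervalIntegrable (fun r => G r v) volume a b := by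
    intro v a b
    rw [intervalIntegrable_iff]
    have : IsFiniteMeasure (volume.restrict (uIoc a b)) := ⟨by simp [uIoc]⟩
    exact ((hG.restrict (uIoc a b)).integrable one_le_two).apply_continuousLinearMap v
  set Φ : ℝ → ℝ := fun t => ‖e t‖ ^ 2 - 2 * ∫ r in (0 : ℝ)..t, G r (E r) with hΦ
  have hcont : ContinuousOn Φ (Icc 0 T) := by
    refine (he.norm.pow 2).sub (Continuous.continuousOn ?_)
    exact continuous_const.mul
      (intervalIntegral.continuous_primitive (fun a b => hGE.intervalIntegrable) 0)
  suffices hs : Φ T = Φ 0 by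
    simp only [hΦ, intervalIntegral.integral_same, mul_zero, sub_zero] at hs
    linarith
  refine eq_of_lintegral_shift_sub_le hT hcont fun κ hκ => ?_
  obtain ⟨c, hc0, hc⟩ : ∃ c : ℝ, 0 < c ∧ eLpNorm G 2 volume * (2 * ENNReal.ofReal c) ≤
      ENNReal.ofReal κ := by
    set M := (eLpNorm G 2 volume).toReal with hM
    have hM0 : 0 ≤ M := ENNReal.toReal_nonneg
    refine ⟨κ / (2 * (M + 1)), by positivity, ?_⟩
    rw [← ENNReal.ofReal_toReal hG.2.ne, ← hM, show (2 : ℝ≥0∞) = ENNReal.ofReal 2 by simp,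
      ← ENNReal.ofReal_mul (by norm_num), ← ENNReal.ofReal_mul hM0]
    refine ENNReal.ofReal_le_ofReal ?_
    rw [show M * (2 * (κ / (2 * (M + 1)))) = M * κ / (M + 1) by field_simp,
      div_le_iff₀ (by positivity)]
    nlinarith
  obtain ⟨h₀, hh₀, hω⟩ := Metric.eventually_nhds_iff.1 ((tendsto_eLpNorm_shift_sub hE).eventually
    (gt_mem_nhds (ENNReal.ofReal_pos.2 hc0)))
  refine ⟨h₀, hh₀, fun η hη hη₀ hηT => ?_⟩
  have hω' : ∀ τ, |τ| < h₀ → eLpNorm (fun s => E (s + τ) - E s) 2 volume ≤ ENNReal.ofReal c :=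
    fun τ hτ => (hω (by simpa [Real.dist_eq] using hτ)).le
  set B : ℝ → ℝ → ℝ≥0∞ := fun s τ =>
    ‖G (s + τ)‖ₑ * ‖E (s + η) - E (s + τ)‖ₑ + ‖G (s + τ)‖ₑ * ‖E s - E (s + τ)‖ₑ with hB
  have hBm : Measurable (Function.uncurry B) := by
    have m1 : Measurable fun x : ℝ × ℝ => x.1 + x.2 := by fun_prop
    have m2 : Measurable fun x : ℝ × ℝ => x.1 + η := by fun_prop
    have g1 := hGm.comp_measurable m1
    have g2 := hEm.comp_measurable m1
    have g3 := hEm.comp_measurable m2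
    have m3 : Measurable fun x : ℝ × ℝ => x.1 := by fun_prop
    have g4 := hEm.comp_measurable m3
    exact (g1.enorm.mul (g3.sub g2).enorm).add (g1.enorm.mul (g4.sub g2).enorm)
  have step1 : ∀ᵐ s, s ∈ Icc 0 (T - η) →
      ‖Φ (s + η) - Φ s‖ₑ ≤ ∫⁻ τ in Ioc 0 η, B s τ := by
    have h' := (measurePreserving_add_right volume η).quasiMeasurePreserving.ae h
    filter_upwards [h, h'] with s hs hs' hsm
    have ms : s ∈ Icc 0 T := ⟨hsm.1, by linarith [hsm.2]⟩
    have ms' : s + η ∈ Icc 0 T := ⟨by linarith [hsm.1], by linarith [hsm.2]⟩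
    have e1 := hs ms s ms (s + η) ms'
    have e2 := hs' ms' s ms (s + η) ms'
    have e3 : Φ (s + η) - Φ s =
        ∫ r in s..(s + η), (G r (E (s + η) - E r) + G r (E s - E r)) := by
      have a1 : ‖e (s + η)‖ ^ 2 - ‖e s‖ ^ 2 =
          inner ℝ (e (s + η) - e s) (e (s + η)) + inner ℝ (e (s + η) - e s) (e s) := by
        simp only [inner_sub_left, real_inner_self_eq_norm_sq, real_inner_comm (e s) (e (s + η))]
        ring
      have a2 := intervalIntegral.integral_interval_sub_left (μ := volume)
        (hGE.intervalIntegrable (a := 0) (b := s + η))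
        (hGE.intervalIntegrable (a := 0) (b := s))
      simp only [map_sub]
      rw [intervalIntegral.integral_add ((hGv _ _ _).sub hGE.intervalIntegrable)
        ((hGv _ _ _).sub hGE.intervalIntegrable), intervalIntegral.integral_sub (hGv _ _ _)
        hGE.intervalIntegrable, intervalIntegral.integral_sub (hGv _ _ _)
        hGE.intervalIntegrable, ← e1, ← e2, ← a2]
      simp only [hΦ]
      linarith
    rw [e3, intervalIntegral.integral_of_le (by linarith)]
    refine (enorm_integral_le_lintegral_enorm _).trans ?_
    have a3 := (measurePreserving_add_left volume s).setLIntegral_comp_preimage_emb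
      (measurableEmbedding_addLeft s)
      (fun r => ‖G r‖ₑ * ‖E (s + η) - E r‖ₑ + ‖G r‖ₑ * ‖E s - E r‖ₑ) (Ioc s (s + η))
    rw [preimage_const_add_Ioc, sub_self, add_sub_cancel_left] at a3
    simp only [hB]
    rw [a3]
    refine lintegral_mono fun r => ?_
    exact (enorm_add_le _ _).trans (add_le_add ((G r).le_opENorm _) ((G r).le_opENorm _))
  have step2 : ∀ τ ∈ Ioc 0 η, ∫⁻ s, B s τ ≤ ENNReal.ofReal κ := by
    intro τ hτ
    have mp := measurePreserving_add_right (volume : Measure ℝ) τ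
    have g1 : AEStronglyMeasurable (fun s => G (s + τ)) volume :=
      (hGm.comp_measurable (measurable_add_const τ)).aestronglyMeasurable
    have g2 : AEStronglyMeasurable (fun s => E (s + τ)) volume :=
      (hEm.comp_measurable (measurable_add_const τ)).aestronglyMeasurable
    have g3 : AEStronglyMeasurable (fun s => E (s + η)) volume :=
      (hEm.comp_measurable (measurable_add_const η)).aestronglyMeasurable
    have n1 : eLpNorm (fun s => G (s + τ)) 2 volume = eLpNorm G 2 volume :=
      eLpNorm_comp_measurePreserving hG.1 mp
    have n2 : eLpNorm (fun s => E (s + η) - E (s + τ)) 2 volume ≤ ENNReal.ofReal c := by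
      have := eLpNorm_comp_measurePreserving (p := 2) (g := fun s => E (s + (η - τ)) - E s)
        ((hEm.comp_measurable (measurable_add_const _)).sub hEm).aestronglyMeasurable mp
      refine le_trans (le_of_eq ?_) (hω' (η - τ) ?_)
      · rw [← this]
        congr 1
        ext s
        simp
      · rw [abs_lt]
        constructor <;> linarith [hτ.1, hτ.2]
    have n3 : eLpNorm (fun s => E s - E (s + τ)) 2 volume ≤ ENNReal.ofReal c := by
      have := hω' τ (by rw [abs_lt]; constructor <;> linarith [hτ.1, hτ.2])
      rw [← eLpNorm_neg] at this
      refine le_trans (le_of_eq ?_) this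
      congr 1
      ext s
      simp
    simp only [hB]
    have gm : AEMeasurable (fun s => ‖G (s + τ)‖ₑ * ‖E (s + η) - E (s + τ)‖ₑ) volume :=
      g1.enorm.mul (g3.sub g2).enorm
    rw [lintegral_add_left' gm]
    refine le_trans (add_le_add (lintegral_enorm_mul_enorm_le g1 (g3.sub g2))
      (lintegral_enorm_mul_enorm_le g1 (hE.1.sub g2))) ?_
    rw [n1]
    refine le_trans (add_le_add (mul_le_mul_right n2 _) (mul_le_mul_right n3 _)) ?_
    rw [← mul_add, ← two_mul]
    exact hc
  calc ∫⁻ s in Icc 0 (T - η), ‖Φ (s + η) - Φ s‖ₑ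
      ≤ ∫⁻ s in Icc 0 (T - η), ∫⁻ τ in Ioc 0 η, B s τ :=
        lintegral_mono_ae ((ae_restrict_iff' measurableSet_Icc).2 step1)
    _ ≤ ∫⁻ s, ∫⁻ τ in Ioc 0 η, B s τ := setLIntegral_le_lintegral _ _
    _ = ∫⁻ τ in Ioc 0 η, ∫⁻ s, B s τ := lintegral_lintegral_swap hBm.aemeasurable
    _ ≤ ∫⁻ τ in Ioc 0 η, ENNReal.ofReal κ := setLIntegral_mono measurable_const step2
    _ = ENNReal.ofReal (κ * η) := by
        rw [setLIntegral_const, Real.volume_Ioc, sub_zero, ENNReal.ofReal_mul hκ.le]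

theorem exists_stronglyMeasurable_memLp_extension {W : Type*} [NormedAddCommGroup W]
    {F : ℝ → W} {s : Set ℝ} (hs : MeasurableSet s) (hF : MemLp F 2 (volume.restrict s)) :
    ∃ F' : ℝ → W, StronglyMeasurable F' ∧ MemLp F' 2 volume ∧ ∀ᵐ r, r ∈ s → F r = F' r := by
  refine ⟨s.indicator (hF.1.mk F), hF.1.stronglyMeasurable_mk.indicator hs,
    (memLp_indicator_iff_restrict hs).2 (hF.ae_eq hF.1.ae_eq_mk), ?_⟩
  filter_upwards [(ae_restrict_iff' hs).1 hF.1.ae_eq_mk] with r h1 hr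
  rw [indicator_of_mem hr, h1 hr]

/-- The energy identity for paths that are square integrable in `V` with a time derivative that
is square integrable in the dual of `V`. -/
theorem energy_identity {T : ℝ} {e : ℝ → H} (he : ContinuousOn e (Icc 0 T))
    {E : ℝ → V} {G : ℝ → StrongDual ℝ V} (hE : MemLp E 2 (volume.restrict (Icc 0 T)))
    (hG : MemLp G 2 (volume.restrict (Icc 0 T)))
    (h : ∀ᵐ s ∂(volume.restrict (Icc 0 T)), ∀ t₁ ∈ Icc 0 T, ∀ t₂ ∈ Icc 0 T,
      inner ℝ (e t₂ - e t₁) (e s) = ∫ r in t₁..t₂, G r (E s)) :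
    ∀ t ∈ Icc 0 T, ‖e t‖ ^ 2 - ‖e 0‖ ^ 2 = 2 * ∫ r in (0 : ℝ)..t, G r (E r) := by
  intro t ht
  rcases ht.1.eq_or_lt with rfl | ht0
  · simp
  have hsub : Icc 0 t ⊆ Icc 0 T := Icc_subset_Icc_right ht.2
  obtain ⟨E', hEm, hE', hEe⟩ := exists_stronglyMeasurable_memLp_extension measurableSet_Icc hE
  obtain ⟨G', hGm, hG', hGe⟩ := exists_stronglyMeasurable_memLp_extension measurableSet_Icc hG
  have key : ∀ᵐ s, s ∈ Icc 0 t → ∀ t₁ ∈ Icc 0 t, ∀ t₂ ∈ Icc 0 t,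
      inner ℝ (e t₂ - e t₁) (e s) = ∫ r in t₁..t₂, G' r (E' s) := by
    filter_upwards [(ae_restrict_iff' measurableSet_Icc).1 h, hEe] with s hs h1 hsm t₁ ht₁ t₂ ht₂
    rw [hs (hsub hsm) t₁ (hsub ht₁) t₂ (hsub ht₂), ← h1 (hsub hsm)]
    refine intervalIntegral.integral_congr_ae ?_
    filter_upwards [hGe] with r h2 hr
    have hr' : r ∈ Icc 0 T := hsub ((ordConnected_Icc.uIcc_subset ht₁ ht₂) (uIoc_subset_uIcc hr))
    rw [h2 hr']
  rw [energy_identity_aux ht0 (he.mono hsub) hE' hG'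
    hEm hGm key]
  congr 1
  refine intervalIntegral.integral_congr_ae ?_
  filter_upwards [hEe, hGe] with r h1 h2 hr
  rw [uIoc_of_le ht0.le] at hr
  have hr' : r ∈ Icc 0 T := ⟨hr.1.le, hr.2.trans ht.2⟩
  rw [h1 hr', h2 hr']

end CHAC

end

noncomputable section

namespace CHAC

theorem le_mul_exp_of_le_add_integral {y : ℝ → ℝ} {T a k : ℝ} (hk : 0 ≤ k)
    (hy : ContinuousOn y (Icc 0 T))
    (h : ∀ t ∈ Icc 0 T, y t ≤ a + k * ∫ s in (0 : ℝ)..t, y s) :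
    ∀ t ∈ Icc 0 T, y t ≤ a * Real.exp (k * t) := by
  intro t ht
  rcases ht.1.eq_or_lt with h0 | h0
  · subst h0
    simpa using h 0 ht
  have hT : 0 ≤ T := ht.1.trans ht.2
  have hint : ∀ t ∈ Icc 0 T, IntervalIntegrable y volume 0 t := fun t ht =>
    (hy.mono (ordConnected_Icc.uIcc_subset ⟨le_rfl, hT⟩ ht)).intervalIntegrable
  have hIcc : IntegrableOn y (Icc 0 T) := hy.integrableOn_compact isCompact_Icc
  set Y : ℝ → ℝ := fun t => a + k * ∫ s in (0 : ℝ)..t, y s with hY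
  have hprim := intervalIntegral.continuousOn_primitive_interval
    (μ := volume) (f := y) (a := 0) (b := T) (by rwa [uIcc_of_le hT])
  rw [uIcc_of_le hT] at hprim
  have hcont : ContinuousOn Y (Icc 0 T) :=
    continuousOn_const.add (continuousOn_const.mul hprim)
  have hder : ∀ x ∈ Ico 0 T, HasDerivWithinAt Y (k * y x) (Ici x) x := by
    intro x hx
    refine HasDerivWithinAt.const_add _ (HasDerivWithinAt.const_mul _ ?_)
    refine intervalIntegral.integral_hasDerivWithinAt_right (hint x ⟨hx.1, hx.2.le⟩)
      (t := Ioi x) ?_ ?_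
    · refine ⟨Ioc x T, Ioc_mem_nhdsGT hx.2, ?_⟩
      exact (hIcc.mono_set (Ioc_subset_Icc_self.trans (Icc_subset_Icc_left hx.1))).aestronglyMeasurable
    · refine (hy x ⟨hx.1, hx.2.le⟩).mono_of_mem_nhdsWithin ?_
      exact mem_of_superset (Ioc_mem_nhdsGT hx.2)
        (Ioc_subset_Icc_self.trans (Icc_subset_Icc_left hx.1))
  have hg := le_gronwallBound_of_liminf_deriv_right_le (f := Y) (f' := fun x => k * y x)
    (δ := a) (K := k) (ε := 0) hcont
    (fun x hx r hr => (hder x hx).liminf_right_slope_le hr) (by simp [hY])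
    (fun x hx => by
      have := mul_le_mul_of_nonneg_left (h x ⟨hx.1, hx.2.le⟩) hk
      simpa using this) t ht
  rw [gronwallBound_ε0, sub_zero] at hg
  exact (h t ht).trans hg

theorem integral_le_toReal_of_ofReal_le {α : Type*} [MeasurableSpace α] {μ : Measure α}
    {f : α → ℝ} (hf : Integrable f μ) {γ : ℝ} (hγ : 0 ≤ γ)
    (h : ∫⁻ x, ENNReal.ofReal (f x) ∂μ ≤ ENNReal.ofReal γ) : ∫ x, f x ∂μ ≤ γ := by
  rw [integral_eq_lintegral_pos_part_sub_lintegral_neg_part hf]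
  have := ENNReal.toReal_mono ENNReal.ofReal_ne_top h
  rw [ENNReal.toReal_ofReal hγ] at this
  linarith [ENNReal.toReal_nonneg (a := ∫⁻ x, ENNReal.ofReal (-f x) ∂μ)]

namespace SpatialDomain

variable {D : SpatialDomain}

/-- The values of the test functions are dense in `L²`. -/
def HasDenseTests (D : SpatialDomain) : Prop :=
  ∀ g : D.H, (∀ p ∈ D.test, inner ℝ g (D.emb p.1) = 0) → g = 0

theorem HasDenseTests.isWeakDeriv_unique (hD : D.HasDenseTests) {i : Fin 2} {u g g' : D.H}
    (h : D.IsWeakDeriv i u g) (h' : D.IsWeakDeriv i u g') : g = g' := by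
  rw [← sub_eq_zero]
  refine hD _ fun p hp => ?_
  rw [inner_sub_left]
  linarith [h p hp, h' p hp]

theorem HasDenseTests.H2_ext (hD : D.HasDenseTests) {U W : D.H2} (h : U.1.1 = W.1.1) : U = W := by
  have h1 : U.1.2.1 = W.1.2.1 := funext fun i =>
    hD.isWeakDeriv_unique (U.2.1 i) (h ▸ W.2.1 i)
  have h2 : U.1.2.2 = W.1.2.2 := funext fun i => funext fun j =>
    hD.isWeakDeriv_unique (U.2.2.1 i j) (h1 ▸ W.2.2.1 i j)
  exact Subtype.ext (Prod.ext h (Prod.ext h1 h2))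

theorem lap_add (U W : D.H2) : lap (U + W) = lap U + lap W := by
  simp [lap, Finset.sum_add_distrib]

theorem lap_smul (c : ℝ) (U : D.H2) : lap (c • U) = c • lap U := by
  simp [lap]

theorem aForm_add_left (ε : ℝ) (U W ψ : D.H2) :
    aForm ε (U + W) ψ = aForm ε U ψ + aForm ε W ψ := by
  simp only [aForm, lap_add, inner_add_left]
  ring

theorem aForm_smul_right (ε c : ℝ) (U ψ : D.H2) : aForm ε U (c • ψ) = c * aForm ε U ψ := by
  simp only [aForm, lap_smul, Submodule.coe_smul, Prod.smul_fst, inner_smul_right]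
  ring

theorem aForm_smul_smul (ε c : ℝ) (U : D.H2) : aForm ε (c • U) (c • U) = c ^ 2 * aForm ε U U := by
  rw [aForm_smul_right]
  simp only [aForm, lap_smul, inner_smul_left, conj_trivial]
  ring

theorem fForm_smul (ε c : ℝ) (w : D.X) (ψ : D.H2) : fForm ε w (c • ψ) = c * fForm ε w ψ := by
  simp only [fForm, lap_smul, Submodule.coe_smul, Prod.smul_fst, inner_smul_right]
  ring

theorem normV_smul (ε c : ℝ) (φ : D.H2) : normV ε (c • φ) = |c| * normV ε φ := by
  rw [normV, normV, aForm_smul_smul, ← Real.sqrt_sq_eq_abs, ← Real.sqrt_mul (sq_nonneg c)]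
  congr 1
  simp only [Submodule.coe_smul, Prod.smul_fst, norm_smul, mul_pow, Real.norm_eq_abs, sq_abs]
  ring

theorem normV_nonneg (ε : ℝ) (φ : D.H2) : 0 ≤ normV ε φ := Real.sqrt_nonneg _

theorem toH1_smul (c : ℝ) (φ : D.H2) : toH1 (c • φ) = c • toH1 φ := rfl

theorem continuous_toH1 : Continuous (toH1 : D.H2 → D.H1) := by
  unfold toH1
  fun_prop

theorem continuous_lap : Continuous (lap : D.H2 → D.H) := by
  unfold lap
  fun_prop

theorem continuous_normV (ε : ℝ) : Continuous (normV ε : D.H2 → ℝ) := by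
  have := continuous_lap (D := D)
  unfold normV aForm
  fun_prop

theorem abs_le_dualNorm_mul_normV {ε : ℝ} {l : D.H2 → ℝ} (hl : ∀ (c : ℝ) φ, l (c • φ) = c * l φ)
    (h : dualNorm ε l ≠ ∞) (φ : D.H2) : |l φ| ≤ (dualNorm ε l).toReal * normV ε φ := by
  set ρ := (dualNorm ε l).toReal
  have h1 : ∀ φ : D.H2, normV ε φ ≤ 1 → |l φ| ≤ ρ := by
    intro φ hφ
    have : ‖l φ‖ₑ ≤ dualNorm ε l := le_iSup₂ (f := fun (φ : D.H2) (_ : normV ε φ ≤ 1) => ‖l φ‖ₑ) φ hφ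
    simpa using ENNReal.toReal_mono h this
  rcases (normV_nonneg ε φ).eq_or_lt with h0 | h0
  · rw [← h0, mul_zero]
    have h2 : ∀ c : ℝ, 0 < c → c * |l φ| ≤ ρ := by
      intro c hc
      have := h1 (c • φ) (by rw [normV_smul, ← h0]; simp)
      rwa [hl, abs_mul, abs_of_pos hc] at this
    by_contra! h3
    have h4 := h2 ((ρ + 1) / |l φ|) (div_pos (by positivity) h3)
    rw [div_mul_cancel₀ _ h3.ne'] at h4
    linarith
  · have := h1 ((normV ε φ)⁻¹ • φ) (by
      rw [normV_smul, abs_of_pos (inv_pos.2 h0), inv_mul_cancel₀ h0.ne'])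
    rwa [hl, abs_mul, abs_of_pos (inv_pos.2 h0), inv_mul_le_iff₀ h0, mul_comm] at this

theorem dualNorm_le_resNorm (hD : D.HasDenseTests) {ε : ℝ} {du : StrongDual ℝ D.H1} {u z : D.X}
    {U : D.H2} (hU : U.1.1 = D.emb u) :
    dualNorm ε (fun φ => du (toH1 φ) - aForm ε U φ - fForm ε (u + z) φ) ≤ resNorm ε du u z := by
  refine le_iInf₂ fun W hW => ?_
  rw [hD.H2_ext (hU.trans hW.symm)]

/-- The pointwise (in time) energy inequality. -/
theorem ofReal_energy_rate_le (hM : D.HasMollifiers) (hD : D.HasDenseTests) {ε : ℝ} (h0 : 0 < ε)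
    (h1 : ε < 1 / 5184) {du : StrongDual ℝ D.H1} {u v z : D.X} {U Φ : D.H2}
    (hU : U.1.1 = D.emb v) (hΦ : Φ.1.1 = D.emb (u - v)) (hz : ε ^ (1 / 4 : ℝ) * ‖u + z‖ ≤ 1) :
    ENNReal.ofReal (2 * (du (toH1 Φ) - aForm ε U Φ - fForm ε (v + z) Φ)
      - 22 * ‖D.emb (u - v)‖ ^ 2) ≤ resNorm ε du u z ^ 2 := by
  by_cases htop : resNorm ε du u z = ∞
  · simp [htop]
  have hW : (U + Φ).1.1 = D.emb u := by
    simp [hU, hΦ]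
  have hle := dualNorm_le_resNorm hD (ε := ε) (du := du) (z := z) hW
  set l : D.H2 → ℝ := fun φ => du (toH1 φ) - aForm ε (U + Φ) φ - fForm ε (u + z) φ with hl
  have hb := abs_le_dualNorm_mul_normV (l := l) (ε := ε) (fun c φ => by
    simp only [hl, toH1_smul, map_smul, aForm_smul_right, fForm_smul, smul_eq_mul]
    ring) (ne_top_of_le_ne_top htop hle) Φ
  have hmono := ENNReal.toReal_mono htop hle
  set ρ := (resNorm ε du u z).toReal with hρ
  have hρ0 : 0 ≤ ρ := ENNReal.toReal_nonneg
  have hN := normV_nonneg ε Φ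
  have hb' : l Φ ≤ ρ * normV ε Φ :=
    (le_abs_self _).trans (hb.trans (mul_le_mul_of_nonneg_right hmono hN))
  have hest := hM.one_sided_estimate h0 h1 ((-1 : ℝ) • Φ) (v - u) (u + z)
    (by simp [hΦ]) hz
  rw [aForm_smul_smul, fForm_smul, fForm_smul, normV_smul,
    show v - u + (u + z) = v + z by ring] at hest
  simp only [Submodule.coe_smul, Prod.smul_fst, norm_smul, hΦ] at hest
  simp only [hl, aForm_add_left] at hb'
  rw [← ENNReal.ofReal_toReal htop, ← hρ, ← ENNReal.ofReal_pow hρ0]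
  refine ENNReal.ofReal_le_ofReal ?_
  norm_num at hest
  rw [map_sub]
  nlinarith [sq_nonneg (normV ε Φ - ρ)]

end SpatialDomain

end CHAC

end

noncomputable section

namespace CHAC

theorem memLp_two_of_continuousOn_Icc {W : Type*} [NormedAddCommGroup W] {F : ℝ → W} {a b : ℝ}
    (hF : ContinuousOn F (Icc a b)) : MemLp F 2 (volume.restrict (Icc a b)) := by
  obtain ⟨C, hC⟩ := isCompact_Icc.exists_bound_of_continuousOn hF
  exact MemLp.of_bound (hF.aestronglyMeasurable measurableSet_Icc) C
    ((ae_restrict_iff' measurableSet_Icc).2 (ae_of_all _ hC))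

theorem memLp_dual_comp {V V' : Type*} [NormedAddCommGroup V] [NormedSpace ℝ V]
    [NormedAddCommGroup V'] [NormedSpace ℝ V'] (P : V' →L[ℝ] V) {α : Type*} [MeasurableSpace α]
    {μ : Measure α} {G : α → StrongDual ℝ V} (hG : MemLp G 2 μ) :
    MemLp (fun r => (G r).comp P) 2 μ :=
  ((ContinuousLinearMap.compL ℝ V' V ℝ).flip P).comp_memLp' hG

theorem memLp_dual_sub {V : Type*} [NormedAddCommGroup V] [NormedSpace ℝ V] {α : Type*}
    [MeasurableSpace α] {μ : Measure α} {F G : α → StrongDual ℝ V} (hF : MemLp F 2 μ)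
    (hG : MemLp G 2 μ) : MemLp (fun r => F r - G r) 2 μ := by
  have h : MemLp (F - G) 2 μ := MemLp.sub hF hG
  exact h

theorem memLp_clm_to_dual {W V : Type*} [NormedAddCommGroup W] [NormedSpace ℝ W]
    [NormedAddCommGroup V] [NormedSpace ℝ V] (B : W →L[ℝ] StrongDual ℝ V) {α : Type*}
    [MeasurableSpace α] {μ : Measure α} {F : α → W} (hF : MemLp F 2 μ) :
    MemLp (fun r => B (F r)) 2 μ :=
  B.comp_memLp' hF

theorem intervalIntegrable_dual_apply {V : Type*} [NormedAddCommGroup V] [NormedSpace ℝ V]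
    {T : ℝ} {G : ℝ → StrongDual ℝ V} (hG : MemLp G 2 (volume.restrict (Icc 0 T))) (x : V) :
    ∀ a ∈ Icc 0 T, ∀ b ∈ Icc 0 T, IntervalIntegrable (fun r => G r x) volume a b := by
  intro a ha b hb
  rw [intervalIntegrable_iff]
  exact IntegrableOn.mono_set ((hG.integrable one_le_two).apply_continuousLinearMap x)
    (uIoc_subset_uIcc.trans (ordConnected_Icc.uIcc_subset ha hb))

namespace SpatialDomain

variable {D : SpatialDomain}

theorem memLp_normV {ε T : ℝ} {v : ℝ → D.X} {U : ℝ → D.H2} (h : MemL2V ε T v U) :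
    MemLp (fun t => normV ε (U t)) 2 (volume.restrict (Icc 0 T)) := by
  refine ⟨(continuous_normV ε).comp_aestronglyMeasurable h.1, ?_⟩
  rw [eLpNorm_lt_top_iff_lintegral_rpow_enorm_lt_top two_ne_zero ENNReal.ofNat_ne_top]
  refine lt_of_le_of_lt (lintegral_mono fun t => le_of_eq ?_) h.2.1
  rw [Real.enorm_of_nonneg (normV_nonneg _ _), ENNReal.ofReal_pow (normV_nonneg _ _)]
  simp

theorem norm_lap_le {ε : ℝ} (h0 : 0 < ε) (h1 : ε ≤ 1 / 2) (φ : D.H2) :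
    ‖lap φ‖ ≤ (√ε)⁻¹ * normV ε φ := by
  rw [← div_eq_inv_mul, le_div_iff₀ (Real.sqrt_pos.2 h0)]
  refine abs_le_of_sq_le_sq' ?_ (normV_nonneg ε φ) |>.2
  rw [mul_pow, Real.sq_sqrt h0.le, normV_sq h0.le (by linarith)]
  have : 0 ≤ 1 - ε := by linarith
  have : 0 ≤ ∑ i, ‖φ.1.2.1 i‖ ^ 2 := Finset.sum_nonneg fun i _ => by positivity
  have : 0 ≤ (1 - ε) * ∑ i, ‖φ.1.2.1 i‖ ^ 2 := by positivity
  nlinarith [sq_nonneg ‖φ.1.1‖]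

theorem norm_toH1_le {ε : ℝ} (h0 : 0 < ε) (h1 : ε ≤ 1 / 2) (φ : D.H2) :
    ‖toH1 φ‖ ≤ (√ε)⁻¹ * normV ε φ := by
  have hs := Real.sqrt_pos.2 h0
  have h1' : 0 ≤ 1 - ε := by linarith
  have hG : 0 ≤ ∑ i, ‖φ.1.2.1 i‖ ^ 2 := Finset.sum_nonneg fun i _ => by positivity
  have hG' : 0 ≤ (1 - ε) * ∑ i, ‖φ.1.2.1 i‖ ^ 2 := by positivity
  have hl : 0 ≤ ε * ‖lap φ‖ ^ 2 := by positivity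
  have key : ∀ x : ℝ, ε * x ^ 2 ≤ normV ε φ ^ 2 → x ≤ (√ε)⁻¹ * normV ε φ := by
    intro x hx
    rw [← div_eq_inv_mul, le_div_iff₀ hs]
    refine abs_le_of_sq_le_sq' ?_ (normV_nonneg ε φ) |>.2
    rwa [mul_pow, Real.sq_sqrt h0.le, mul_comm]
  have h2 : ‖toH1 φ‖ = max ‖φ.1.1‖ ‖φ.1.2.1‖ := rfl
  rw [h2]
  refine max_le (key _ ?_) ((pi_norm_le_iff_of_nonneg (by have := normV_nonneg ε φ; positivity)).2
    fun i => key _ ?_)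
  · rw [normV_sq h0.le (by linarith)]
    nlinarith [sq_nonneg ‖φ.1.1‖]
  · rw [normV_sq h0.le (by linarith)]
    have h3 : ‖φ.1.2.1 i‖ ^ 2 ≤ ∑ i, ‖φ.1.2.1 i‖ ^ 2 :=
      Finset.single_le_sum (f := fun i => ‖φ.1.2.1 i‖ ^ 2) (fun i _ => by positivity)
        (Finset.mem_univ i)
    nlinarith [sq_nonneg ‖φ.1.1‖, sq_nonneg ‖φ.1.2.1 i‖]

/-- The functional `(w, l) ↦ (1 - ε) ⟨h, w⟩ - ε ⟨h, l⟩` on `H¹ × L²`. -/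
def splitForm (D : SpatialDomain) (ε : ℝ) : D.H →L[ℝ] StrongDual ℝ (D.H1 × D.H) :=
  LinearMap.mkContinuous₂
    (LinearMap.mk₂ ℝ (fun (h : D.H) (x : D.H1 × D.H) =>
        (1 - ε) * inner ℝ h x.1.1.1 - ε * inner ℝ h x.2)
      (by intro a b x; simp only [inner_add_left]; ring)
      (by intro c a x; simp only [inner_smul_left, conj_trivial, smul_eq_mul]; ring)
      (by
        intro a x y
        simp only [Prod.fst_add, Prod.snd_add, Submodule.coe_add, inner_add_right]
        ring)
      (by
        intro c a x
        simp only [Prod.smul_fst, Prod.smul_snd, Submodule.coe_smul, inner_smul_right, smul_eq_mul]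
        ring))
    (|1 - ε| + |ε|) (by
      intro h x
      have a1 := abs_real_inner_le_norm h x.1.1.1
      have a2 := abs_real_inner_le_norm h x.2
      have b1 : ‖x.1.1.1‖ ≤ ‖x‖ := (norm_fst_le x.1.1).trans (norm_fst_le x)
      have b2 : ‖x.2‖ ≤ ‖x‖ := norm_snd_le x
      rw [LinearMap.mk₂_apply, Real.norm_eq_abs]
      calc |(1 - ε) * inner ℝ h x.1.1.1 - ε * inner ℝ h x.2|
          ≤ |1 - ε| * |inner ℝ h x.1.1.1| + |ε| * |inner ℝ h x.2| := by
            rw [← abs_mul, ← abs_mul]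
            exact abs_sub _ _
        _ ≤ |1 - ε| * (‖h‖ * ‖x‖) + |ε| * (‖h‖ * ‖x‖) := by
            gcongr
            · exact a1.trans (by gcongr)
            · exact a2.trans (by gcongr)
        _ = _ := by ring)

theorem error_energy_identity {ε T : ℝ} (h0 : 0 < ε) (h1 : ε ≤ 1 / 2)
    {u v z : ℝ → D.X} {du : ℝ → StrongDual ℝ D.H1} {U Φ : ℝ → D.H2}
    (hu : ContinuousOn u (Icc 0 T)) (hdu : IsTimeDeriv T u du) (hz : ContinuousOn z (Icc 0 T))
    (hv : ContinuousOn v (Icc 0 T)) (hU : MemL2V ε T v U)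
    (hveq : ∀ ψ : D.H2, ∀ t ∈ Icc 0 T,
      inner ℝ (D.emb (v t)) ψ.1.1 = inner ℝ (D.emb (v 0)) ψ.1.1
        + (∫ s in (0 : ℝ)..t, aForm ε (U s) ψ)
        + ∫ s in (0 : ℝ)..t, fForm ε (v s + z s) ψ)
    (hΦ : MemL2V ε T (fun t => u t - v t) Φ) :
    IntegrableOn (fun r => du r (toH1 (Φ r)) - aForm ε (U r) (Φ r) - fForm ε (v r + z r) (Φ r))
      (Icc 0 T) ∧
    ∀ t ∈ Icc 0 T, ‖D.emb (u t - v t)‖ ^ 2 - ‖D.emb (u 0 - v 0)‖ ^ 2 =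
      2 * ∫ r in (0 : ℝ)..t,
        (du r (toH1 (Φ r)) - aForm ε (U r) (Φ r) - fForm ε (v r + z r) (Φ r)) := by
  set G₁ : ℝ → StrongDual ℝ (D.H1 × D.H) := fun r =>
    (du r).comp (ContinuousLinearMap.fst ℝ D.H1 D.H) with hG₁
  set G₂ : ℝ → StrongDual ℝ (D.H1 × D.H) := fun r => D.splitForm ε (lap (U r)) with hG₂
  set G₃ : ℝ → StrongDual ℝ (D.H1 × D.H) := fun r =>
    D.splitForm ε (D.emb (cubic (v r + z r))) with hG₃
  have m₁ : MemLp G₁ 2 (volume.restrict (Icc 0 T)) := by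
    exact memLp_dual_comp (ContinuousLinearMap.fst ℝ D.H1 D.H) hdu.1
  have m₂ : MemLp G₂ 2 (volume.restrict (Icc 0 T)) := by
    refine memLp_clm_to_dual (D.splitForm ε) ?_
    refine MemLp.of_le_mul (memLp_normV hU) (continuous_lap.comp_aestronglyMeasurable hU.1)
      (c := (√ε)⁻¹) (ae_of_all _ fun r => ?_)
    rw [Real.norm_of_nonneg (normV_nonneg _ _)]
    exact norm_lap_le h0 h1 _
  have m₃ : MemLp G₃ 2 (volume.restrict (Icc 0 T)) := by
    refine memLp_clm_to_dual (D.splitForm ε) (memLp_two_of_continuousOn_Icc ?_)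
    have hc : Continuous (cubic : D.X → D.X) := by
      unfold cubic
      fun_prop
    exact D.emb.continuous.comp_continuousOn (hc.comp_continuousOn (hv.add hz))
  set E : ℝ → D.H1 × D.H := fun r => (toH1 (Φ r), lap (Φ r)) with hE
  have mE : MemLp E 2 (volume.restrict (Icc 0 T)) := by
    refine MemLp.of_le_mul (memLp_normV hΦ)
      ((continuous_toH1.prodMk continuous_lap).comp_aestronglyMeasurable hΦ.1)
      (c := (√ε)⁻¹) (ae_of_all _ fun r => ?_)
    rw [Real.norm_of_nonneg (normV_nonneg _ _)]
    exact max_le (norm_toH1_le h0 h1 _) (norm_lap_le h0 h1 _)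
  have mG : MemLp (fun r => G₁ r - G₂ r - G₃ r) 2 (volume.restrict (Icc 0 T)) :=
    memLp_dual_sub (memLp_dual_sub m₁ m₂) m₃
  have hGE : ∀ r, (G₁ r - G₂ r - G₃ r) (E r) =
      du r (toH1 (Φ r)) - aForm ε (U r) (Φ r) - fForm ε (v r + z r) (Φ r) := fun r => rfl
  have he : ContinuousOn (fun t => D.emb (u t - v t)) (Icc 0 T) :=
    D.emb.continuous.comp_continuousOn (hu.sub hv)
  have hweak : ∀ ψ : D.H2, ∀ t ∈ Icc 0 T, inner ℝ (D.emb (u t - v t)) ψ.1.1 =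
      inner ℝ (D.emb (u 0 - v 0)) ψ.1.1 +
        ∫ r in (0 : ℝ)..t, (G₁ r - G₂ r - G₃ r) (toH1 ψ, lap ψ) := by
    intro ψ t ht
    have m0 : (0 : ℝ) ∈ Icc 0 T := ⟨le_rfl, ht.1.trans ht.2⟩
    have i₁ := intervalIntegrable_dual_apply m₁ (toH1 ψ, lap ψ) 0 m0 t ht
    have i₂ := intervalIntegrable_dual_apply m₂ (toH1 ψ, lap ψ) 0 m0 t ht
    have i₃ := intervalIntegrable_dual_apply m₃ (toH1 ψ, lap ψ) 0 m0 t ht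
    have e1 : inner ℝ (D.emb (u t)) ψ.1.1 = inner ℝ (D.emb (u 0)) ψ.1.1 +
      ∫ r in (0 : ℝ)..t, G₁ r (toH1 ψ, lap ψ) := hdu.2 (toH1 ψ) t ht
    have e2 : inner ℝ (D.emb (v t)) ψ.1.1 = inner ℝ (D.emb (v 0)) ψ.1.1
        + (∫ r in (0 : ℝ)..t, G₂ r (toH1 ψ, lap ψ))
        + ∫ r in (0 : ℝ)..t, G₃ r (toH1 ψ, lap ψ) := hveq ψ t ht
    simp only [sub_apply]
    rw [intervalIntegral.integral_sub (i₁.sub i₂) i₃, intervalIntegral.integral_sub i₁ i₂,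
      map_sub, map_sub, inner_sub_left, inner_sub_left]
    linarith
  have hid := energy_identity he mE mG (by
    filter_upwards [hΦ.2.2] with s hs t₁ ht₁ t₂ ht₂
    have m0 : (0 : ℝ) ∈ Icc 0 T := ⟨le_rfl, ht₁.1.trans ht₁.2⟩
    rw [← hs, inner_sub_left, hweak _ t₁ ht₁, hweak _ t₂ ht₂, ← intervalIntegral.integral_interval_sub_left
      (intervalIntegrable_dual_apply mG (E s) 0 m0 t₂ ht₂)
      (intervalIntegrable_dual_apply mG (E s) 0 m0 t₁ ht₁)]
    ring)
  exact ⟨integrable_dual_apply mE mG, hid⟩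

/-- The pathwise error estimate. -/
theorem pathwise_error_estimate (hM : D.HasMollifiers) (hD : D.HasDenseTests) {ε T γ : ℝ}
    (h0 : 0 < ε) (h1 : ε < 1 / 5184) (hγ : 0 ≤ γ)
    {u v z : ℝ → D.X} {du : ℝ → StrongDual ℝ D.H1}
    (hu : ContinuousOn u (Icc 0 T)) (hdu : IsTimeDeriv T u du) (hz : ContinuousOn z (Icc 0 T))
    (hv : IsTransformedSolution ε T z v) (hΦ : ∃ Φ, MemL2V ε T (fun t => u t - v t) Φ)
    (hsmall : ∀ t ∈ Icc 0 T, ε ^ (1 / 4 : ℝ) * ‖u t + z t‖ ≤ 1)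
    (hinit : ‖D.emb (u 0 - v 0)‖ ^ 2 ≤ γ)
    (hres : ∫⁻ t in Icc 0 T, resNorm ε (du t) (u t) (z t) ^ 2 ≤ ENNReal.ofReal γ) :
    ∀ t ∈ Icc 0 T, ‖D.emb (u t - v t)‖ ^ 2 ≤ 2 * γ * Real.exp (22 * T) := by
  obtain ⟨Φ, hΦ⟩ := hΦ
  obtain ⟨hvc, U, hU, hveq⟩ := hv
  obtain ⟨hint, hid⟩ := error_energy_identity h0 (by linarith) hu hdu hz hvc hU hveq hΦ
  set R : ℝ → ℝ := fun r =>
    du r (toH1 (Φ r)) - aForm ε (U r) (Φ r) - fForm ε (v r + z r) (Φ r) with hR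
  set y : ℝ → ℝ := fun t => ‖D.emb (u t - v t)‖ ^ 2 with hy
  have hyc : ContinuousOn y (Icc 0 T) :=
    (D.emb.continuous.comp_continuousOn (hu.sub hvc)).norm.pow 2
  have hyi : IntegrableOn y (Icc 0 T) := hyc.integrableOn_compact isCompact_Icc
  have hmain : ∀ t ∈ Icc 0 T, y t ≤ 2 * γ + 22 * ∫ s in (0 : ℝ)..t, y s := by
    intro t ht
    have hsub : Ioc 0 t ⊆ Icc 0 T := Ioc_subset_Icc_self.trans (Icc_subset_Icc_right ht.2)
    have iR : IntegrableOn R (Ioc 0 t) := hint.mono_set hsub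
    have iy : IntegrableOn y (Ioc 0 t) := hyi.mono_set hsub
    have hle : ∫ r in Ioc 0 t, (2 * R r - 22 * y r) ≤ γ := by
      refine integral_le_toReal_of_ofReal_le ((iR.const_mul 2).sub (iy.const_mul 22)) hγ ?_
      refine (lintegral_mono_set hsub).trans (le_trans (lintegral_mono_ae ?_) hres)
      filter_upwards [hU.2.2, hΦ.2.2, ae_restrict_mem measurableSet_Icc] with r hr1 hr2 hr3
      exact ofReal_energy_rate_le hM hD h0 h1 hr1 hr2 (hsmall r hr3)
    rw [integral_sub (iR.const_mul 2) (iy.const_mul 22), integral_const_mul,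
      integral_const_mul] at hle
    have := hid t ht
    rw [intervalIntegral.integral_of_le ht.1] at this ⊢
    simp only [hy] at hle hinit ⊢
    linarith
  intro t ht
  refine (le_mul_exp_of_le_add_integral (by norm_num) hyc hmain t ht).trans ?_
  have := ht.2
  gcongr

end SpatialDomain

end CHAC

end

noncomputable section

namespace CHAC

theorem continuous_partialDeriv {η : Plane → ℝ} (hη : ContDiff ℝ (⊤ : ℕ∞) η) (i : Fin 2) :
    Continuous (partialDeriv i η) :=
  (hη.continuous_fderiv (by simp)).clm_apply continuous_const

theorem partialDeriv_mul {φ ψ : Plane → ℝ} (hφ : ContDiff ℝ (⊤ : ℕ∞) φ)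
    (hψ : ContDiff ℝ (⊤ : ℕ∞) ψ) (i : Fin 2) (x : Plane) :
    partialDeriv i (fun y => φ y * ψ y) x =
      partialDeriv i φ x * ψ x + φ x * partialDeriv i ψ x := by
  have h1 : DifferentiableAt ℝ φ x := hφ.differentiable (by simp) x
  have h2 : DifferentiableAt ℝ ψ x := hψ.differentiable (by simp) x
  unfold partialDeriv
  rw [fderiv_fun_mul h1 h2]
  simp only [add_apply, smul_apply, smul_eq_mul]
  ring

theorem partialDeriv_neg_of_even {η : Plane → ℝ} (hs : ContDiff ℝ (⊤ : ℕ∞) η)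
    (hη : ∀ y, η (-y) = η y) (i : Fin 2) (y : Plane) :
    partialDeriv i η (-y) = -partialDeriv i η y := by
  unfold partialDeriv
  have h1 : (fun y => η (-y)) = η := funext hη
  have h2 : HasFDerivAt (fun y => η (-y)) _ y :=
    (hs.differentiable (by simp) (-y)).hasFDerivAt.comp y (hasFDerivAt_id y).neg
  rw [h1] at h2
  rw [h2.fderiv]
  simp

theorem tsupport_partialDeriv_subset (η : Plane → ℝ) (i : Fin 2) :
    tsupport (partialDeriv i η) ⊆ tsupport η := tsupport_fderiv_apply_subset ℝ _

theorem hasCompactSupport_partialDeriv {η : Plane → ℝ} (hη : HasCompactSupport η) (i : Fin 2) :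
    HasCompactSupport (partialDeriv i η) := hη.fderiv_apply ℝ _

theorem contDiff_convolution {η A : Plane → ℝ} (hη : ContDiff ℝ (⊤ : ℕ∞) η)
    (hηc : HasCompactSupport η) (hA : Continuous A) :
    ContDiff ℝ (⊤ : ℕ∞) (convolution η A (ContinuousLinearMap.lsmul ℝ ℝ) volume) :=
  hηc.contDiff_convolution_left _ hη hA.locallyIntegrable

theorem partialDeriv_convolution {η A : Plane → ℝ} (hη : ContDiff ℝ (⊤ : ℕ∞) η)
    (hηc : HasCompactSupport η) (hA : Continuous A) (i : Fin 2) (x : Plane) :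
    partialDeriv i (convolution η A (ContinuousLinearMap.lsmul ℝ ℝ) volume) x =
      convolution (partialDeriv i η) A (ContinuousLinearMap.lsmul ℝ ℝ) volume x := by
  have h1 := hηc.hasFDerivAt_convolution_left (ContinuousLinearMap.lsmul ℝ ℝ)
    (hη.of_le (by simp)) hA.locallyIntegrable (μ := volume) x
  have h2 := (hηc.fderiv ℝ).convolutionExists_left_of_continuous_right
    ((ContinuousLinearMap.lsmul ℝ ℝ : ℝ →L[ℝ] ℝ →L[ℝ] ℝ).precompL Plane)
    (hη.continuous_fderiv (by simp)).locallyIntegrable hA (μ := volume) x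
  unfold partialDeriv
  rw [h1.fderiv]
  simp only [convolution]
  rw [ContinuousLinearMap.integral_apply h2]
  rfl

/-- Approximation by convolution, uniformly on the plane. -/
theorem exists_bump_radius {A : Plane → ℝ} (hA : UniformContinuous A) {κ : ℝ} (hκ : 0 < κ) :
    ∃ δ > 0, ∀ φ : ContDiffBump (0 : Plane), φ.rOut ≤ δ → ∀ x,
      |convolution (φ.normed volume) A (ContinuousLinearMap.lsmul ℝ ℝ) volume x - A x| ≤ κ := by
  obtain ⟨δ, hδ, h⟩ := Metric.uniformContinuous_iff.1 hA κ hκ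
  refine ⟨δ, hδ, fun φ hφ x => ?_⟩
  rw [← Real.dist_eq]
  refine φ.dist_normed_convolution_le hA.continuous.aestronglyMeasurable fun y hy => ?_
  exact (h (lt_of_lt_of_le hy hφ)).le

theorem uniformContinuous_of_compactSupport {A : Plane → ℝ} (hA : Continuous A)
    (hc : HasCompactSupport A) : UniformContinuous A :=
  hA.uniformContinuous_of_tendsto_cocompact hc.is_zero_at_infty

section Group

variable {M : Type*} [AddCommGroup M]

/-- Convolution of a function on a group with a function on the plane, along a homomorphism. -/
def groupConv (π : Plane →+ M) (η : Plane → ℝ) (a : M → ℝ) (x : M) : ℝ :=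
  ∫ y, η y * a (x - π y)

theorem groupConv_apply_hom (π : Plane →+ M) (η : Plane → ℝ) (a : M → ℝ) (x : Plane) :
    groupConv π η a (π x) =
      convolution η (fun y => a (π y)) (ContinuousLinearMap.lsmul ℝ ℝ) volume x := by
  rw [convolution_lsmul]
  simp [groupConv]

variable [TopologicalSpace M] [IsTopologicalAddGroup M] [MeasurableSpace M] [BorelSpace M]
  {m : Measure M}

/-- Convolution with an odd function is antisymmetric. -/
theorem integral_mul_groupConv [SFinite m] [m.IsAddLeftInvariant] [IsFiniteMeasureOnCompacts m]
    {π : Plane →+ M} (hπ : Continuous π) {η : Plane → ℝ} (hη : Continuous η)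
    (hηc : HasCompactSupport η) (hodd : ∀ y, η (-y) = -η y) {a b : M → ℝ} (ha : Continuous a)
    (hac : HasCompactSupport a) (hb : Continuous b) :
    ∫ x, b x * groupConv π η a x ∂m = -∫ x, a x * groupConv π η b x ∂m := by
  have hint : ∀ (c d : M → ℝ), Continuous c → Continuous d → (HasCompactSupport c ∨ HasCompactSupport d) →
      Integrable (fun z : M × Plane => c z.1 * (η z.2 * d (z.1 - π z.2))) (m.prod volume) := by
    intro c d hc hd hcd
    have hcont : Continuous fun z : M × Plane => c z.1 * (η z.2 * d (z.1 - π z.2)) := by fun_prop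
    refine hcont.integrable_of_hasCompactSupport ?_
    rcases hcd with h | h
    · refine HasCompactSupport.intro (h.isCompact.prod hηc.isCompact) fun z hz => ?_
      by_cases h1 : z.1 ∈ tsupport c
      · have h2 : z.2 ∉ tsupport η := fun h2 => hz ⟨h1, h2⟩
        rw [image_eq_zero_of_notMem_tsupport h2]
        ring
      · rw [image_eq_zero_of_notMem_tsupport h1]
        ring
    · have hK : IsCompact ((fun z : M × Plane => (z.1 + π z.2, z.2)) ''
          (tsupport d ×ˢ tsupport η)) :=
        (h.isCompact.prod hηc.isCompact).image (by fun_prop)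
      refine HasCompactSupport.intro hK fun z hz => ?_
      by_cases h1 : z.1 - π z.2 ∈ tsupport d
      · have h2 : z.2 ∉ tsupport η := fun h2 => hz ⟨(z.1 - π z.2, z.2), ⟨h1, h2⟩, by simp⟩
        rw [image_eq_zero_of_notMem_tsupport h2]
        ring
      · rw [image_eq_zero_of_notMem_tsupport h1]
        ring
  have swap : ∀ (c d : M → ℝ), Continuous c → Continuous d →
      (HasCompactSupport c ∨ HasCompactSupport d) →
      ∫ x, c x * groupConv π η d x ∂m = ∫ y, η y * ∫ x, c x * d (x - π y) ∂m := by
    intro c d hc hd hcd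
    simp only [groupConv, ← integral_const_mul]
    rw [integral_integral_swap (hint c d hc hd hcd)]
    refine integral_congr_ae (ae_of_all _ fun y => integral_congr_ae (ae_of_all _ fun x => ?_))
    simp only
    ring
  rw [swap b a hb ha (Or.inr hac), swap a b ha hb (Or.inl hac),
    ← integral_neg_eq_self (fun y => η y * ∫ x, a x * b (x - π y) ∂m), ← integral_neg]
  refine integral_congr_ae (ae_of_all _ fun y => ?_)
  simp only [hodd, map_neg, sub_neg_eq_add, neg_mul, neg_neg]
  congr 1
  rw [← integral_add_right_eq_self (fun x => b x * a (x - π y)) (π y)]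
  refine integral_congr_ae (ae_of_all _ fun x => ?_)
  simp [mul_comm]

end Group

end CHAC

end

noncomputable section

namespace CHAC

/-- The covering map of the torus as a homomorphism. -/
def torusHom : Plane →+ Torus2 where
  toFun := torusProj
  map_zero' := by
    ext i
    simp [torusProj]
  map_add' x y := by
    ext i
    simp [torusProj]

theorem continuous_torusHom : Continuous torusHom := by
  refine continuous_pi fun i => ?_
  exact (AddCircle.continuous_mk' _).comp (by fun_prop)

theorem surjective_torusProj : Function.Surjective torusProj := by
  intro x
  choose y hy using fun i => QuotientAddGroup.mk_surjective (x i)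
  exact ⟨WithLp.toLp 2 y, funext hy⟩

theorem uniformContinuous_lift (a : C(Torus2, ℝ)) :
    UniformContinuous fun x => a (torusHom x) :=
  (CompactSpace.uniformContinuous_of_continuous a.continuous).comp
    (uniformContinuous_addMonoidHom_of_continuous continuous_torusHom)

/-- Convolution of a function on the torus with a function on the plane. -/
def torusConv (η : Plane → ℝ) (hη : Continuous η) (hηc : HasCompactSupport η) (a : C(Torus2, ℝ)) :
    C(Torus2, ℝ) where
  toFun := groupConv torusHom η a
  continuous_toFun := by
    have h : groupConv torusHom η a = fun x => ∫ y in tsupport η, η y * a (x - torusHom y) := by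
      funext x
      refine (setIntegral_eq_integral_of_forall_compl_eq_zero fun y hy => ?_).symm
      rw [image_eq_zero_of_notMem_tsupport hy, zero_mul]
    rw [h]
    have := continuous_torusHom
    exact continuous_parametric_integral_of_continuous
      (f := fun x y => η y * a (x - torusHom y)) (by fun_prop) hηc

theorem torusConv_mem_test {η : Plane → ℝ} (hη : ContDiff ℝ (⊤ : ℕ∞) η)
    (hηc : HasCompactSupport η) (a : C(Torus2, ℝ)) :
    ((torusConv η hη.continuous hηc a, fun i => torusConv (partialDeriv i η)
      (continuous_partialDeriv hη i) (hasCompactSupport_partialDeriv hηc i) a) :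
      C(Torus2, ℝ) × (Fin 2 → C(Torus2, ℝ))) ∈ torus.test := by
  have h : ∀ (θ : Plane → ℝ), (fun x : Plane => groupConv torusHom θ a (torusProj x)) =
      convolution θ (fun y => a (torusHom y)) (ContinuousLinearMap.lsmul ℝ ℝ) volume :=
    fun θ => funext fun x => groupConv_apply_hom torusHom θ a x
  have hA := (uniformContinuous_lift a).continuous
  refine ⟨?_, fun i x => ?_⟩
  · change ContDiff ℝ _ fun x : Plane => groupConv torusHom η a (torusProj x)
    rw [h]
    exact contDiff_convolution hη hηc hA
  · change groupConv torusHom (partialDeriv i η) a (torusProj x) =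
      partialDeriv i (fun x : Plane => groupConv torusHom η a (torusProj x)) x
    rw [h, partialDeriv_convolution hη hηc hA]
    exact groupConv_apply_hom torusHom _ a x

theorem mul_mem_torus_test {p q : C(Torus2, ℝ) × (Fin 2 → C(Torus2, ℝ))} (hp : p ∈ torus.test)
    (hq : q ∈ torus.test) :
    ((p.1 * q.1, fun i => p.2 i * q.1 + p.1 * q.2 i) : C(Torus2, ℝ) × (Fin 2 → C(Torus2, ℝ)))
      ∈ torus.test := by
  refine ⟨hp.1.mul hq.1, fun i x => ?_⟩
  refine Eq.trans ?_ (partialDeriv_mul hp.1 hq.1 i x).symm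
  rw [← hp.2, ← hq.2]
  rfl

open SpatialDomain in
theorem hasMollifiers_torus : torus.HasMollifiers := by
  intro (p : C(Torus2, ℝ) × (Fin 2 → C(Torus2, ℝ))) hp (v : C(Torus2, ℝ)) (w : C(Torus2, ℝ)) κ hκ
  set S : ℝ := 1 + ‖p.1‖ + ∑ i, ‖p.2 i‖ with hS
  have hS0 : 0 < S := by positivity
  have hS2 : ∀ i, ‖p.2 i‖ ≤ S := by
    intro i
    have := Finset.single_le_sum (f := fun i => ‖p.2 i‖) (fun i _ => norm_nonneg _)
      (Finset.mem_univ i)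
    have := norm_nonneg p.1
    linarith
  have hS1 : ‖p.1‖ ≤ S := by
    have : 0 ≤ ∑ i, ‖p.2 i‖ := by positivity
    linarith
  obtain ⟨δ₁, hδ₁, h₁⟩ := exists_bump_radius (uniformContinuous_lift w) (div_pos hκ hS0)
  obtain ⟨δ₂, hδ₂, h₂⟩ := exists_bump_radius (uniformContinuous_lift (v * p.1)) hκ
  have hδ : 0 < min δ₁ δ₂ := lt_min hδ₁ hδ₂
  let φ : ContDiffBump (0 : Plane) := ⟨min δ₁ δ₂ / 2, min δ₁ δ₂, by positivity, by linarith⟩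
  set η := φ.normed volume with hη
  have ηs : ContDiff ℝ (⊤ : ℕ∞) η := φ.contDiff_normed
  have ηc : HasCompactSupport η := φ.hasCompactSupport_normed
  have ηe : ∀ y, η (-y) = η y := φ.normed_neg
  let Q : C(Torus2, ℝ) → C(Torus2, ℝ) × (Fin 2 → C(Torus2, ℝ)) := fun a =>
    (torusConv η ηs.continuous ηc a, fun i => torusConv (partialDeriv i η)
      (continuous_partialDeriv ηs i) (hasCompactSupport_partialDeriv ηc i) a)
  have hQ : ∀ a, Q a ∈ torus.test := fun a => torusConv_mem_test ηs ηc a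
  have hw : ‖(Q w).1 - w‖ ≤ κ / S := by
    refine (ContinuousMap.norm_le _ (by positivity)).2 fun x => ?_
    obtain ⟨x, rfl⟩ := surjective_torusProj x
    have := h₁ φ (min_le_left _ _) x
    rwa [← groupConv_apply_hom] at this
  refine ⟨(Q w).1, (Q w).2, Q (v * p.1), hQ _, mul_mem_torus_test hp (hQ w), ?_, fun i => ?_,
    fun i => ?_, ?_⟩
  · calc ‖p.1 * ((Q w).1 - w)‖ ≤ ‖p.1‖ * ‖(Q w).1 - w‖ := norm_mul_le _ _
      _ ≤ S * (κ / S) := by gcongr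
      _ = κ := by field_simp
  · calc ‖p.2 i * ((Q w).1 - w)‖ ≤ ‖p.2 i‖ * ‖(Q w).1 - w‖ := norm_mul_le _ _
      _ ≤ S * (κ / S) := by gcongr; exact hS2 i
      _ = κ := by field_simp
  · refine (inner_emb_emb (D := torus) _ _).trans (Eq.trans ?_
      (congrArg Neg.neg (inner_emb_emb (D := torus) _ _)).symm)
    exact integral_mul_groupConv (m := (volume : Measure Torus2)) continuous_torusHom
      (continuous_partialDeriv ηs i) (hasCompactSupport_partialDeriv ηc i)
      (partialDeriv_neg_of_even ηs ηe i) w.continuous (HasCompactSupport.of_compactSpace _)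
      (v * p.1).continuous
  · refine (ContinuousMap.norm_le _ hκ.le).2 fun x => ?_
    obtain ⟨x, rfl⟩ := surjective_torusProj x
    have := h₂ φ (min_le_right _ _) x
    rwa [← groupConv_apply_hom] at this

theorem one_mem_torus_test :
    ((1, 0) : C(Torus2, ℝ) × (Fin 2 → C(Torus2, ℝ))) ∈ torus.test := by
  refine ⟨contDiff_const, fun i x => ?_⟩
  change (0 : ℝ) = partialDeriv i (fun _ => (1 : ℝ)) x
  simp [partialDeriv]

open SpatialDomain in
theorem hasDenseTests_torus : torus.HasDenseTests := by
  intro g hg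
  have h1 : ∀ v : torus.X, inner ℝ g (torus.emb v) = 0 := by
    intro v
    rw [← abs_eq_zero]
    refine le_antisymm (le_of_forall_pos_le_add fun κ hκ => ?_) (abs_nonneg _)
    set c := ‖g‖ * ‖torus.emb‖ with hc
    have hc0 : 0 ≤ c := by positivity
    obtain ⟨q, q', r, hr, -, -, -, -, h⟩ :=
      hasMollifiers_torus _ one_mem_torus_test v v (κ / (c + 1)) (by positivity)
    have h2 := abs_inner_emb_le g h
    rw [map_sub, inner_sub_right, hg r hr, zero_sub, abs_neg] at h2
    have h3 : v * 1 = v := mul_one v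
    have h4 : κ / (c + 1) * c ≤ κ := by
      rw [div_mul_eq_mul_div, div_le_iff₀ (by positivity)]
      nlinarith
    rw [zero_add]
    exact (congrArg (fun a => |inner ℝ g (torus.emb a)|) h3).symm.le.trans (h2.trans h4)
  have h2 : DenseRange torus.emb :=
    ContinuousMap.toLp_denseRange (α := Torus2) ℝ volume ℝ ENNReal.ofNat_ne_top
  refine h2.eq_zero_of_inner_left ℝ ?_
  exact h1

theorem separableSpace_torus : TopologicalSpace.SeparableSpace torus.H := by
  have : Fact ((2 : ℝ≥0∞) ≠ ∞) := ⟨ENNReal.ofNat_ne_top⟩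
  exact inferInstanceAs (TopologicalSpace.SeparableSpace (Lp ℝ 2 (volume : Measure Torus2)))

end CHAC

end

noncomputable section

namespace CHAC

variable {U : Set Plane} (hU : IsSmoothBoundedDomain U)

/-- Restriction to the closed domain of a continuous function on the plane. -/
def restrictClosure (U : Set Plane) (A : Plane → ℝ) (hA : Continuous A) : C(closure U, ℝ) :=
  ⟨fun x => A x, by fun_prop⟩

theorem map_comap_restrict (U : Set Plane) :
    (((volume : Measure Plane).restrict U).comap ((↑) : closure U → Plane)).map (↑) =
      volume.restrict U := by
  rw [map_comap_subtype_coe isClosed_closure.measurableSet,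
    Measure.restrict_restrict isClosed_closure.measurableSet,
    inter_eq_self_of_subset_right subset_closure]

theorem measurableEmbedding_coe_closure :
    MeasurableEmbedding ((↑) : closure U → Plane) :=
  MeasurableEmbedding.subtype_coe isClosed_closure.measurableSet

theorem integral_neumann (F : Plane → ℝ) :
    ∫ x : closure U, F x ∂(neumann U hU).μ = ∫ x in U, F x := by
  rw [← map_comap_restrict U]
  exact (measurableEmbedding_coe_closure.integral_map F).symm

theorem exists_compactSupport_extension (hU : IsSmoothBoundedDomain U) (v : C(closure U, ℝ)) :
    ∃ A : Plane → ℝ, Continuous A ∧ HasCompactSupport A ∧ ∀ x : closure U, A x = v x := by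
  obtain ⟨g, hg⟩ := ContinuousMap.exists_restrict_eq (isClosed_closure (s := U)) v
  obtain ⟨R, hR⟩ := hU.isBounded.closure.subset_closedBall (0 : Plane)
  let φ : ContDiffBump (0 : Plane) := ⟨max R 1, max R 1 + 1, by positivity, by linarith⟩
  refine ⟨fun x => φ x * g x, φ.continuous.mul g.continuous, φ.hasCompactSupport.mul_right,
    fun x => ?_⟩
  have h1 : φ (x : Plane) = 1 :=
    φ.one_of_mem_closedBall (Metric.closedBall_subset_closedBall (le_max_left _ _) (hR x.2))
  have h2 : g x = v x := DFunLike.congr_fun hg x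
  simp only [h1, h2, one_mul]

theorem mem_neumann_test {ψ : Plane → ℝ} (hψ : ContDiff ℝ (⊤ : ℕ∞) ψ) (hc : HasCompactSupport ψ)
    (hs : tsupport ψ ⊆ U) :
    ((restrictClosure U ψ hψ.continuous, fun i => restrictClosure U (partialDeriv i ψ)
      (continuous_partialDeriv hψ i)) : C(closure U, ℝ) × (Fin 2 → C(closure U, ℝ))) ∈
      (neumann U hU).test :=
  ⟨ψ, hψ, hc, hs, fun _ => rfl, fun _ _ => rfl⟩

theorem groupConv_id (η a : Plane → ℝ) :
    groupConv (AddMonoidHom.id Plane) η a =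
      convolution η a (ContinuousLinearMap.lsmul ℝ ℝ) volume :=
  funext fun x => groupConv_apply_hom (AddMonoidHom.id Plane) η a x

theorem tsupport_convolution_bump_subset (φ : ContDiffBump (0 : Plane)) {a : Plane → ℝ}
    {K : Set Plane} (ha : tsupport a ⊆ K) :
    tsupport (convolution (φ.normed volume) a (ContinuousLinearMap.lsmul ℝ ℝ) volume) ⊆
      Metric.cthickening φ.rOut K := by
  refine closure_minimal ?_ Metric.isClosed_cthickening
  refine (support_convolution_subset _).trans ?_
  rintro x ⟨y, hy, z, hz, rfl⟩
  rw [φ.support_normed_eq, mem_ball_zero_iff] at hy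
  refine Metric.mem_cthickening_of_dist_le _ z _ _ (ha (subset_tsupport a hz)) ?_
  simpa using hy.le

open SpatialDomain in
theorem hasMollifiers_neumann : (neumann U hU).HasMollifiers := by
  intro (p : C(closure U, ℝ) × (Fin 2 → C(closure U, ℝ))) hp (v : C(closure U, ℝ))
    (w : C(closure U, ℝ)) κ hκ
  obtain ⟨φp, hφs, hφc, hφU, hp1, hp2⟩ := hp
  have : CompactSpace (closure U) := (neumann U hU).comp
  set S : ℝ := 1 + ‖p.1‖ + ∑ i, ‖p.2 i‖ with hS
  have hS0 : 0 < S := by positivity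
  have hS2 : ∀ i, ‖p.2 i‖ ≤ S := by
    intro i
    have := Finset.single_le_sum (f := fun i => ‖p.2 i‖) (fun i _ => norm_nonneg _)
      (Finset.mem_univ i)
    have := norm_nonneg p.1
    linarith
  have hS1 : ‖p.1‖ ≤ S := by
    have : 0 ≤ ∑ i, ‖p.2 i‖ := by positivity
    linarith
  obtain ⟨A, hA, hAc, hAv⟩ := exists_compactSupport_extension hU v
  obtain ⟨B, hB, hBc, hBw⟩ := exists_compactSupport_extension hU w
  set a : Plane → ℝ := fun x => A x * φp x with ha
  have hac : Continuous a := hA.mul hφs.continuous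
  have hacs : HasCompactSupport a := hφc.mul_left
  have hats : tsupport a ⊆ tsupport φp := tsupport_mul_subset_right
  obtain ⟨δ₁, hδ₁, h₁⟩ := exists_bump_radius (uniformContinuous_of_compactSupport hB hBc)
    (div_pos hκ hS0)
  obtain ⟨δ₂, hδ₂, h₂⟩ := exists_bump_radius (uniformContinuous_of_compactSupport hac hacs) hκ
  obtain ⟨δ₃, hδ₃, h₃⟩ := hφc.isCompact.exists_cthickening_subset_open hU.isOpen hφU
  have hδ : 0 < min (min δ₁ δ₂) δ₃ := lt_min (lt_min hδ₁ hδ₂) hδ₃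
  let φ : ContDiffBump (0 : Plane) :=
    ⟨min (min δ₁ δ₂) δ₃ / 2, min (min δ₁ δ₂) δ₃, by positivity, by linarith⟩
  have hr1 : φ.rOut ≤ δ₁ := (min_le_left _ _).trans (min_le_left _ _)
  have hr2 : φ.rOut ≤ δ₂ := (min_le_left _ _).trans (min_le_right _ _)
  have hr3 : φ.rOut ≤ δ₃ := min_le_right _ _
  set η := φ.normed volume with hη
  have ηs : ContDiff ℝ (⊤ : ℕ∞) η := φ.contDiff_normed
  have ηc : HasCompactSupport η := φ.hasCompactSupport_normed
  have ηe : ∀ y, η (-y) = η y := φ.normed_neg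
  set q := convolution η B (ContinuousLinearMap.lsmul ℝ ℝ) volume with hq
  set r := convolution η a (ContinuousLinearMap.lsmul ℝ ℝ) volume with hr
  have hqs : ContDiff ℝ (⊤ : ℕ∞) q := contDiff_convolution ηs ηc hB
  have hrs : ContDiff ℝ (⊤ : ℕ∞) r := contDiff_convolution ηs ηc hac
  have hrt : tsupport r ⊆ U := (tsupport_convolution_bump_subset φ hats).trans
    ((Metric.cthickening_mono hr3 _).trans h₃)
  have hrc : HasCompactSupport r := ηc.convolution _ hacs
  have hw : ‖restrictClosure U q hqs.continuous - w‖ ≤ κ / S := by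
    refine (ContinuousMap.norm_le _ (by positivity)).2 fun x => ?_
    have := h₁ φ hr1 x
    rwa [hBw] at this
  refine ⟨restrictClosure U q hqs.continuous,
    fun i => restrictClosure U (partialDeriv i q) (continuous_partialDeriv hqs i),
    _, mem_neumann_test hU hrs hrc hrt, ?_, ?_, fun i => ?_, fun i => ?_, ?_⟩
  · refine ⟨fun x => φp x * q x, hφs.mul hqs, hφc.mul_right,
      (tsupport_mul_subset_left).trans hφU, fun x => ?_, fun i x => ?_⟩
    · exact congrArg (· * q (x : Plane)) (hp1 x)
    · rw [partialDeriv_mul hφs hqs]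
      exact congrArg₂ (fun s t => s * q (x : Plane) + t * partialDeriv i q x) (hp2 i x) (hp1 x)
  · calc ‖p.1 * (restrictClosure U q hqs.continuous - w)‖
        ≤ ‖p.1‖ * ‖restrictClosure U q hqs.continuous - w‖ := norm_mul_le _ _
      _ ≤ S * (κ / S) := by gcongr
      _ = κ := by field_simp
  · calc ‖p.2 i * (restrictClosure U q hqs.continuous - w)‖
        ≤ ‖p.2 i‖ * ‖restrictClosure U q hqs.continuous - w‖ := norm_mul_le _ _
      _ ≤ S * (κ / S) := by gcongr; exact hS2 i
      _ = κ := by field_simp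
  · refine (inner_emb_emb (D := neumann U hU) _ _).trans (Eq.trans ?_
      (congrArg Neg.neg (inner_emb_emb (D := neumann U hU) _ _)).symm)
    have e1 : ∀ x : closure U, (v * p.1) x * partialDeriv i q x = a x * partialDeriv i q x := by
      intro x
      simp only [ha, ContinuousMap.mul_apply, hAv, hp1 x]
    have e2 : ∀ x : closure U, w x * partialDeriv i r x = B x * partialDeriv i r x := by
      intro x
      rw [hBw]
    have e3 := integral_neumann hU (fun x => a x * partialDeriv i q x)
    have e4 := integral_neumann hU (fun x => B x * partialDeriv i r x)
    rw [setIntegral_eq_integral_of_forall_compl_eq_zero] at e3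
    swap
    · intro x hx
      rw [image_eq_zero_of_notMem_tsupport fun h => hx (hφU (hats h)), zero_mul]
    rw [setIntegral_eq_integral_of_forall_compl_eq_zero] at e4
    swap
    · intro x hx
      rw [image_eq_zero_of_notMem_tsupport fun h =>
        hx (hrt (tsupport_partialDeriv_subset r i h)), mul_zero]
    have e5 := integral_mul_groupConv (m := (volume : Measure Plane))
      (π := AddMonoidHom.id Plane) continuous_id (continuous_partialDeriv ηs i)
      (hasCompactSupport_partialDeriv ηc i) (partialDeriv_neg_of_even ηs ηe i) hB hBc hac
    have e6 : groupConv (AddMonoidHom.id Plane) (partialDeriv i η) B = partialDeriv i q := by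
      rw [groupConv_id]
      exact funext fun x => (partialDeriv_convolution ηs ηc hB i x).symm
    have e7 : groupConv (AddMonoidHom.id Plane) (partialDeriv i η) a = partialDeriv i r := by
      rw [groupConv_id]
      exact funext fun x => (partialDeriv_convolution ηs ηc hac i x).symm
    rw [e6, e7] at e5
    refine (integral_congr_ae (ae_of_all _ e1)).trans (e3.trans (e5.trans (congrArg Neg.neg ?_)))
    exact e4.symm.trans (integral_congr_ae (ae_of_all _ e2)).symm
  · refine (ContinuousMap.norm_le _ hκ.le).2 fun (x : closure U) => ?_
    have h := h₂ φ hr2 x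
    have e1 : a x = (v * p.1) x := by
      simp only [ha, ContinuousMap.mul_apply, hAv, hp1 x]
    rw [e1] at h
    exact h

open SpatialDomain in
theorem hasDenseTests_neumann : (neumann U hU).HasDenseTests := by
  intro (g : Lp ℝ 2 (neumann U hU).μ) hg
  have : CompactSpace (closure U) := (neumann U hU).comp
  set G : Plane → ℝ := Function.extend ((↑) : closure U → Plane) g 0 with hG
  have hGx : ∀ x : closure U, G x = g x := fun x =>
    Subtype.val_injective.extend_apply g 0 x
  have hemb : MeasurableEmbedding ((↑) : closure U → Plane) := measurableEmbedding_coe_closure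
  set ν := ((volume : Measure Plane).restrict U).comap ((↑) : closure U → Plane) with hν
  have hgi : Integrable (fun x : closure U => g x) ν := by
    have : IsFiniteMeasure (neumann U hU).μ := (neumann U hU).fin
    exact (Lp.memLp g).integrable one_le_two
  have hGi : IntegrableOn G U volume := by
    rw [IntegrableOn, ← map_comap_restrict U, hemb.integrable_map_iff]
    exact hgi.congr (ae_of_all _ fun x => (hGx x).symm)
  have h0 := hU.isOpen.ae_eq_zero_of_integral_contDiff_smul_eq_zero (μ := volume)
    hGi.locallyIntegrableOn (fun ψ hψ hc hs => by
      have h1 := hg _ (mem_neumann_test hU hψ hc hs)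
      rw [inner_coeFn_emb] at h1
      have h2 := integral_neumann hU (fun x => ψ x • G x)
      rw [setIntegral_eq_integral_of_forall_compl_eq_zero] at h2
      swap
      · intro x hx
        rw [image_eq_zero_of_notMem_tsupport fun h => hx (hs h), zero_smul]
      rw [← h2, ← h1]
      refine integral_congr_ae (ae_of_all _ fun (x : closure U) => ?_)
      change ψ x * G x = g x * ψ x
      rw [hGx, mul_comm])
  rw [← ae_restrict_iff' hU.isOpen.measurableSet, ← map_comap_restrict U, hemb.ae_map_iff] at h0
  have h1 : ∀ᵐ x : closure U ∂ν, g x = 0 := by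
    filter_upwards [h0] with x hx
    exact (hGx x).symm.trans hx
  exact (Lp.eq_zero_iff_ae_eq_zero).2 h1

theorem separableSpace_neumann : TopologicalSpace.SeparableSpace (neumann U hU).H := by
  have : Fact ((2 : ℝ≥0∞) ≠ ∞) := ⟨ENNReal.ofNat_ne_top⟩
  have : IsFiniteMeasure ((volume.restrict U).comap ((↑) : closure U → Plane)) :=
    (neumann U hU).fin
  exact inferInstanceAs (TopologicalSpace.SeparableSpace
    (Lp ℝ 2 ((volume.restrict U).comap ((↑) : closure U → Plane))))

end CHAC

end

noncomputable section

namespace CHAC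

namespace SpatialDomain

variable {D : SpatialDomain}

theorem IsStochasticConvolution.ae_emb_zero_eq_zero [TopologicalSpace.SeparableSpace D.H]
    {Ω : Type*} [MeasurableSpace Ω]
    {P : Measure Ω} {ξ : D.TimeL2 →ₗ[ℝ] Lp ℝ 2 P} {ε σ T : ℝ} {Z : Ω → ℝ → D.X} (hT : 0 ≤ T)
    (h : IsStochasticConvolution P ξ ε σ T Z) : ∀ᵐ ω ∂P, D.emb (Z ω 0) = 0 := by
  obtain ⟨S, -, hS⟩ := h
  have h1 : ∀ x : D.H, ∀ᵐ ω ∂P, inner ℝ (D.emb (Z ω 0)) x = 0 := by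
    intro x
    obtain ⟨g, hg, hZ⟩ := hS 0 ⟨le_rfl, hT⟩ x
    have hg0 : g = 0 := by
      rw [Lp.eq_zero_iff_ae_eq_zero]
      filter_upwards [hg, ae_restrict_mem measurableSet_Ici] with s hs hs0
      rw [hs, if_neg (not_lt.2 hs0)]
      rfl
    rw [hg0, map_zero] at hZ
    filter_upwards [hZ, Lp.coeFn_zero ℝ 2 P] with ω h1 h2
    rw [h1, h2]
    rfl
  have h2 := ae_all_iff.2 fun n => h1 (TopologicalSpace.denseSeq D.H n)
  filter_upwards [h2] with ω hω
  refine (TopologicalSpace.denseRange_denseSeq D.H).eq_zero_of_inner_left ℝ ?_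
  exact hω

end SpatialDomain

open SpatialDomain in
/-- The error estimate in probability. -/
theorem error_estimate {D : SpatialDomain} (hM : D.HasMollifiers) (hD : D.HasDenseTests)
    [TopologicalSpace.SeparableSpace D.H] {T : ℝ} (hT : 0 < T) {C₀ : ℝ} {u : ℝ → D.X}
    {du : ℝ → StrongDual ℝ D.H1} (hu : IsLimitSolution T C₀ u du) :
    ∃ ε₀ > (0 : ℝ), ∀ ε : ℝ, 0 < ε → ε < ε₀ →
      ∀ (Ω : Type*) [MeasurableSpace Ω] (P : Measure Ω) [IsProbabilityMeasure P]
        (ξ : D.TimeL2 →ₗ[ℝ] Lp ℝ 2 P) (σ : ℝ) (Z uε : Ω → ℝ → D.X),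
        IsStochasticConvolution P ξ ε σ T Z →
        (∀ᵐ ω ∂P, ContinuousOn (Z ω) (Icc 0 T)) →
        (∀ᵐ ω ∂P, IsTransformedSolution ε T (Z ω) (fun t => uε ω t - Z ω t)) →
        (∀ᵐ ω ∂P, ∃ Φ : ℝ → D.H2, MemL2V ε T (fun t => u t - (uε ω t - Z ω t)) Φ) →
        ∀ γ : ℝ, 0 < γ →
          P {ω | ENNReal.ofReal (2 * Real.exp (22 * T) * γ)
              < ⨆ t ∈ Icc 0 T, ‖D.emb (uε ω t - u t - Z ω t)‖ₑ ^ 2}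
            ≤ P {ω | 1 / 2 < ENNReal.ofReal (ε ^ (1 / 4 : ℝ)) * ⨆ t ∈ Icc 0 T, ‖Z ω t‖ₑ}
              + P {ω | γ < ‖D.emb (u 0 - uε ω 0)‖ ^ 2}
              + P {ω | ENNReal.ofReal γ
                  < ∫⁻ t in Icc 0 T, resNorm ε (du t) (u t) (Z ω t) ^ 2} := by
  obtain ⟨huc, hdu, -⟩ := hu
  obtain ⟨M, hMu⟩ := isCompact_Icc.exists_bound_of_continuousOn huc
  have hM0 : 0 ≤ M := (norm_nonneg _).trans (hMu 0 ⟨le_rfl, hT.le⟩)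
  refine ⟨min (1 / 5184) ((1 / (2 * (M + 1))) ^ 4), by positivity, ?_⟩
  intro ε h0 hε Ω _ P _ ξ σ Z uε hZ hZc hsol hΦ γ hγ
  have hε1 := hε.trans_le (min_le_left _ _)
  have hε2 := hε.trans_le (min_le_right _ _)
  have hs0 : 0 < ε ^ (1 / 4 : ℝ) := Real.rpow_pos_of_pos h0 _
  have hsM : ε ^ (1 / 4 : ℝ) * M ≤ 1 / 2 := by
    have h4 : (ε ^ (1 / 4 : ℝ)) ^ 4 = ε := by
      rw [← Real.rpow_natCast, ← Real.rpow_mul h0.le]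
      norm_num
    have h5 : ε ^ (1 / 4 : ℝ) < 1 / (2 * (M + 1)) :=
      lt_of_pow_lt_pow_left₀ 4 (by positivity) (by rwa [h4])
    rw [lt_div_iff₀ (by positivity)] at h5
    nlinarith
  refine le_trans (measure_mono_ae ?_) ((measure_union_le _ _).trans
    (add_le_add (measure_union_le _ _) le_rfl))
  filter_upwards [hZ.ae_emb_zero_eq_zero hT.le, hZc, hsol, hΦ] with ω w1 w2 w3 w4 hω
  by_contra hcon
  obtain ⟨h12, c3⟩ := not_or.1 hcon
  obtain ⟨c1, c2⟩ := not_or.1 h12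
  rw [notMem_ofPred_iff, not_lt] at c1 c2
  replace c3 := not_lt.1 (notMem_ofPred_iff.1 c3)
  have hZb : ∀ t ∈ Icc 0 T, ε ^ (1 / 4 : ℝ) * ‖Z ω t‖ ≤ 1 / 2 := by
    intro t ht
    have h1 : ENNReal.ofReal (ε ^ (1 / 4 : ℝ)) * ‖Z ω t‖ₑ ≤ 1 / 2 :=
      (mul_le_mul_right (le_iSup₂ (f := fun t (_ : t ∈ Icc 0 T) => ‖Z ω t‖ₑ) t ht) _).trans c1
    rw [← ofReal_norm, ← ENNReal.ofReal_mul hs0.le] at h1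
    have h2 : (1 / 2 : ℝ≥0∞) = ENNReal.ofReal (1 / 2) := by
      rw [ENNReal.ofReal_div_of_pos (by norm_num)]
      simp
    rw [h2] at h1
    exact (ENNReal.ofReal_le_ofReal_iff (by norm_num)).1 h1
  have hpath := pathwise_error_estimate hM hD h0 hε1 hγ.le huc hdu w2 w3 w4
    (fun t ht => by
      have h1 := norm_add_le (u t) (Z ω t)
      have h2 := mul_le_mul_of_nonneg_left h1 hs0.le
      have h3 := mul_le_mul_of_nonneg_left (hMu t ht) hs0.le
      linarith [hZb t ht])
    (by
      have : u 0 - (uε ω 0 - Z ω 0) = (u 0 - uε ω 0) + Z ω 0 := by abel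
      rw [this, map_add, w1, add_zero]
      exact c2) c3
  refine absurd hω (not_lt.2 (iSup₂_le fun t ht => ?_))
  rw [show uε ω t - u t - Z ω t = -(u t - (uε ω t - Z ω t)) by abel, map_neg, enorm_neg,
    ← ofReal_norm, ← ENNReal.ofReal_pow (norm_nonneg _)]
  refine ENNReal.ofReal_le_ofReal ((hpath t ht).trans (le_of_eq ?_))
  ring

end CHAC

end

open CHAC SpatialDomain in
theorem hasMollifiers_of_isPeriodicOrNeumann {D : SpatialDomain} (hD : D.IsPeriodicOrNeumann) :
    D.HasMollifiers := by
  rcases hD with rfl | ⟨U, hU, rfl⟩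
  · exact hasMollifiers_torus
  · exact hasMollifiers_neumann hU

open CHAC SpatialDomain in
theorem hasDenseTests_of_isPeriodicOrNeumann {D : SpatialDomain} (hD : D.IsPeriodicOrNeumann) :
    D.HasDenseTests := by
  rcases hD with rfl | ⟨U, hU, rfl⟩
  · exact hasDenseTests_torus
  · exact hasDenseTests_neumann hU

open CHAC SpatialDomain in
theorem separableSpace_of_isPeriodicOrNeumann {D : SpatialDomain} (hD : D.IsPeriodicOrNeumann) :
    TopologicalSpace.SeparableSpace D.H := by
  rcases hD with rfl | ⟨U, hU, rfl⟩
  · exact separableSpace_torus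
  · exact separableSpace_neumann hU

open CHAC SpatialDomain in
theorem mainTheorem5 (D : SpatialDomain) (hD : D.IsPeriodicOrNeumann) :
    -- the one-sided nonlinear estimate with `X = C⁰` and `c_ε = ε^{1/4}`
    (∃ δ > (0 : ℝ), ∃ C ≥ (0 : ℝ), ∃ ε₁ > (0 : ℝ), ∀ ε : ℝ, 0 < ε → ε < ε₁ →
      ∀ (φ : D.H2) (w ψ : D.X), φ.1.1 = D.emb w → ε ^ (1 / 4 : ℝ) * ‖ψ‖ ≤ 1 →
        aForm ε φ φ + (fForm ε (w + ψ) φ - fForm ε ψ φ)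
          ≤ - δ * normV ε φ ^ 2 + C * ‖φ.1.1‖ ^ 2) ∧
    -- the error estimate
    (∀ T : ℝ, 0 < T → ∃ K > (0 : ℝ),
      ∀ (C₀ : ℝ) (u : ℝ → D.X) (du : ℝ → StrongDual ℝ D.H1), IsLimitSolution T C₀ u du →
      ∃ ε₀ > (0 : ℝ), ∀ ε : ℝ, 0 < ε → ε < ε₀ →
      ∀ (Ω : Type*) [MeasurableSpace Ω] (P : Measure Ω) [IsProbabilityMeasure P]
        (ξ : D.TimeL2 →ₗ[ℝ] Lp ℝ 2 P) (σ : ℝ) (Z uε : Ω → ℝ → D.X),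
        IsWhiteNoise P ξ →
        IsStochasticConvolution P ξ ε σ T Z →
        (∀ᵐ ω ∂P, ContinuousOn (Z ω) (Icc 0 T)) →
        (∀ᵐ ω ∂P, IsTransformedSolution ε T (Z ω) (fun t => uε ω t - Z ω t)) →
        (∀ᵐ ω ∂P, ∃ Φ : ℝ → D.H2, MemL2V ε T (fun t => u t - (uε ω t - Z ω t)) Φ) →
        ∀ γ : ℝ, 0 < γ →
          P {ω | ENNReal.ofReal (K * γ)
              < ⨆ t ∈ Icc 0 T, ‖D.emb (uε ω t - u t - Z ω t)‖ₑ ^ 2}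
            ≤ P {ω | 1 / 2 < ENNReal.ofReal (ε ^ (1 / 4 : ℝ)) * ⨆ t ∈ Icc 0 T, ‖Z ω t‖ₑ}
              + P {ω | γ < ‖D.emb (u 0 - uε ω 0)‖ ^ 2}
              + P {ω | ENNReal.ofReal γ
                  < ∫⁻ t in Icc 0 T, resNorm ε (du t) (u t) (Z ω t) ^ 2}) := by
  have hM := hasMollifiers_of_isPeriodicOrNeumann hD
  have hT := hasDenseTests_of_isPeriodicOrNeumann hD
  have := separableSpace_of_isPeriodicOrNeumann hD
  refine ⟨⟨1 / 2, by norm_num, 11, by norm_num, 1 / 5184, by norm_num,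
    fun ε h0 h1 φ w ψ hw hψ => hM.one_sided_estimate h0 h1 φ w ψ hw hψ⟩, fun T hTpos => ?_⟩
  refine ⟨2 * Real.exp (22 * T), by positivity, fun C₀ u du hu => ?_⟩
  obtain ⟨ε₀, hε₀, h⟩ := error_estimate hM hT hTpos hu
  refine ⟨ε₀, hε₀, fun ε h0 h1 Ω _ P _ ξ σ Z uε _ hZ hZc hsol hΦ γ hγ => ?_⟩
  exact h ε h0 h1 Ω P ξ σ Z uε hZ hZc hsol hΦ γ hγ
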